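/- All hypergraphs are finite, without repeated hyperedges. Let $k\ge 2$. For a $k$-uniform hypergraph $\mathcal H$ on $n$ vertices let $\mathcal A(\mathcal H)$ be its adjacency tensor (of order $k$ and dimension $n$, with entry $a_{i_1\cdots i_k}=\frac1{(k-1)!}$ if $\{i_1,\dots,i_k\}$ is a hyperedge and $0$ otherwise), let $\mathcal D(\mathcal H)$ be the diagonal tensor of vertex degrees, and for $0<\alpha<1$ put $\mathcal A_\alpha(\mathcal H)=\alpha\mathcal D(\mathcal H)+(1-\alpha)\mathcal A(\mathcal H)$. The $d$-th order trace of a tensor $\mathcal T$ of order $k$ and dimension $n$ is $$\mathrm{Tr}_d(\mathcal T)=(k-1)^{n-1}\sum_{d_1+\cdots+d_n=d}\ \prod_{i=1}^n\frac1{(d_i(k-1))!}\Big(\sum_{\beta\in[n]^{k-1}}\mathcal T_{i\beta}\frac{\partial}{\partial a_{i\beta}}\Big)^{d_i}\mathrm{tr}\big(A^{d(k-1)}\big),$$ where $A=(a_{ij})$ is an $n\times n$ matrix of indeterminates, the $d_i$ are nonnegative integers, and $\frac{\partial}{\partial a_{i\beta}}=\frac{\partial}{\partial a_{i i_2}}\cdots\frac{\partial}{\partial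 a_{i i_k}}$ for $\beta=i_2\cdots i_k$. For $k$-uniform hypergraphs $\mathcal H_1,\mathcal H_2$ with the same number $n$ of vertices, write $\mathcal H_1\prec_\alpha\mathcal H_2$ ($\mathcal H_1$ comes before $\mathcal H_2$ in $S_\alpha$-order) if there is an integer $d$ with $1\le d\le n(k-1)^{n-1}-1$ such that $\mathrm{Tr}_t(\mathcal A_\alpha(\mathcal H_1))=\mathrm{Tr}_t(\mathcal A_\alpha(\mathcal H_2))$ for $t=0,1,\dots,d-1$ and $\mathrm{Tr}_d(\mathcal A_\alpha(\mathcal H_1))<\mathrm{Tr}_d(\mathcal A_\alpha(\mathcal H_2))$. A hypertree is a connected hypergraph without cycles, where a cycle consists of $q\ge2$ distinct vertices $v_1,\dots,v_q$ and $q$ distinct hyperedges $e_1,\dots,e_q$ with $v_i,v_{i+1}\in e_i$ (indices modulo $q$). The starlike hypertree $S^{(k)}_{n_1,\dots,n_r}$ is obtained from $k$-uniform hyperpaths of lengths $n_1,\dots,n_r$ by identifying one end vertex of each of them to a single common vertex. **Theorem.** Let $k\ge2$, $m\ge3$ and $0<\alpha<1$. Among all $k$-uniform hypertrees with $m$ hyperedges,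 the second last hypertree in $S_\alpha$-order is the starlike hypertree $S^{(k)}_{1,2,1,\dots,1}$ (with $m-1$ hyperpaths, one of length $2$ and the others of length $1$). That is, among these hypertrees there is a last one $L$ (every one of them not isomorphic to $L$ comes strictly before $L$), $S^{(k)}_{1,2,1,\dots,1}$ is a $k$-uniform hypertree with $m$ hyperedges not isomorphic to $L$, and $T\prec_\alpha S^{(k)}_{1,2,1,\dots,1}$ for every $k$-uniform hypertree $T$ with $m$ hyperedges that is isomorphic neither to $L$ nor to $S^{(k)}_{1,2,1,\dots,1}$. -/

import Mathlib

/-! ### Tensors and their traces -/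

/-- Tensors of order `k` over `R` with index set `V`; the entry `a_{i i₂ ⋯ iₖ}` is written
`A i α` with `α = (i₂, …, iₖ)`. -/
abbrev KTensor (R V : Type*) (k : ℕ) : Type _ := V → (Fin (k - 1) → V) → R

namespace KTensor

variable {R V : Type*} [Field R] {k : ℕ}

/-- The differential operator `∂/∂a_{iα} = ∂/∂a_{i i₂} ⋯ ∂/∂a_{i iₖ}` on polynomials in the
entries `a_{ij}` of an auxiliary matrix. -/
noncomputable def partialOp (R : Type*) {V : Type*} [Field R] {k : ℕ} (i : V)
    (α : Fin (k - 1) → V) : Module.End R (MvPolynomial (V × V) R) :=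
  (List.ofFn fun j => (MvPolynomial.pderiv (R := R) (i, α j)).toLinearMap).prod

/-- The differential operator `∑_α A_{iα} ∂/∂a_{iα}`. -/
noncomputable def rowOp [Fintype V] (A : KTensor R V k) (i : V) :
    Module.End R (MvPolynomial (V × V) R) :=
  ∑ α : Fin (k - 1) → V, A i α • partialOp R i α

theorem pderiv_commute (p q : V × V) :
    Commute ((MvPolynomial.pderiv (R := R) p).toLinearMap : Module.End R (MvPolynomial (V × V) R))
      (MvPolynomial.pderiv (R := R) q).toLinearMap := by
  have h : ⁅MvPolynomial.pderiv (R := R) p, MvPolynomial.pderiv (R := R) q⁆ = 0 := by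
    classical
    apply MvPolynomial.derivation_ext
    intro r
    simp only [Derivation.commutator_apply, MvPolynomial.pderiv_X, Derivation.coe_zero,
      Pi.zero_apply, Pi.single_apply]
    split_ifs <;> simp
  refine LinearMap.ext fun x => ?_
  have := congrArg (fun D => D x) h
  simp only [Derivation.commutator_apply, Derivation.coe_zero, Pi.zero_apply] at this
  exact sub_eq_zero.mp this

theorem partialOp_commute (i j : V) (α β : Fin (k - 1) → V) :
    Commute (partialOp R i α) (partialOp R j β) := by
  refine Commute.list_prod_right _ _ fun x hx => Commute.list_prod_left _ _ fun y hy => ?_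
  obtain ⟨a, rfl⟩ := List.mem_ofFn.mp hx
  obtain ⟨b, rfl⟩ := List.mem_ofFn.mp hy
  exact pderiv_commute _ _

theorem rowOp_commute [Fintype V] (A : KTensor R V k) (i j : V) :
    Commute (rowOp A i) (rowOp A j) :=
  Commute.sum_right _ _ _ fun _ _ => Commute.sum_left _ _ _ fun _ _ =>
    ((partialOp_commute _ _ _ _).smul_left _).smul_right _

theorem rowOp_pow_pairwise [Fintype V] (A : KTensor R V k) (c : V → ℕ) :
    ((Finset.univ : Finset V) : Set V).Pairwise
      (Function.onFun Commute fun i => rowOp A i ^ c i) :=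
  fun i _ j _ _ => (rowOp_commute A i j).pow_pow (c i) (c j)

/-- The `d`-th order trace of a tensor of order `k` and dimension `n = |V|`:
`(k-1)^{n-1} ∑_{∑ dᵢ = d} ∏ᵢ (1 / (dᵢ(k-1))!) (∑_α A_{iα} ∂/∂a_{iα})^{dᵢ} tr(a^{d(k-1)})`,
where `a = (a_{ij})` is the auxiliary matrix of indeterminates. The polynomial that the operators
produce has degree `0`; its value is read off as its constant coefficient. -/
noncomputable def trace [Fintype V] [DecidableEq V] (A : KTensor R V k) (d : ℕ) : R :=
  ((k - 1 : ℕ) : R) ^ (Fintype.card V - 1) *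
    ∑ c ∈ Finset.piAntidiag (Finset.univ : Finset V) d,
      (∏ i, (1 / ((c i * (k - 1)).factorial : R))) *
        MvPolynomial.constantCoeff
          (Finset.univ.noncommProd (fun i => rowOp A i ^ c i) (rowOp_pow_pairwise A c)
            (Matrix.trace
              ((Matrix.of fun i j : V => (MvPolynomial.X (i, j) : MvPolynomial (V × V) R)) ^
                (d * (k - 1)))))

end KTensor

/-! ### Hypergraphs -/

namespace Hypergraph

variable {V : Type*}

/-- Every hyperedge has exactly `k` vertices. -/
def IsUniform (H : Hypergraph V) (k : ℕ) : Prop := ∀ e ∈ H.edgeSet, e.encard = k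

/-- The number of hyperedges containing `v`. -/
noncomputable def deg (H : Hypergraph V) (v : V) : ℕ := {e | e ∈ H.edgeSet ∧ v ∈ e}.ncard

/-- Nonempty, and any two vertices are joined by a walk. -/
def IsConnected (H : Hypergraph V) : Prop :=
  H.vertexSet.Nonempty ∧
    ∀ u ∈ H.vertexSet, ∀ v ∈ H.vertexSet, Relation.ReflTransGen H.Adj u v

/-- A cycle of length `q` is a closed alternating sequence `v₀, e₀, v₁, e₁, …, e_{q-1}, v₀` of
`q ≥ 2` distinct vertices and `q` distinct hyperedges with `vᵢ, vᵢ₊₁ ∈ eᵢ`, indices modulo `q`. -/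
def IsCycle (H : Hypergraph V) {q : ℕ} (v : Fin q → V) (e : Fin q → Set V) : Prop :=
  2 ≤ q ∧ Function.Injective v ∧ Function.Injective e ∧
    ∀ i, e i ∈ H.edgeSet ∧ v i ∈ e i ∧ v (finRotate q i) ∈ e i

/-- A hypertree is a connected hypergraph without cycles. -/
def IsHypertree (H : Hypergraph V) : Prop :=
  H.IsConnected ∧ ∀ (q : ℕ) (v : Fin q → V) (e : Fin q → Set V), ¬ H.IsCycle v e

open Classical in
/-- The adjacency tensor of a `k`-uniform hypergraph. -/
noncomputable def adjTensor (H : Hypergraph V) (k : ℕ) : KTensor ℝ V k := fun i α =>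
  if insert i (Set.range α) ∈ H.edgeSet then 1 / ((k - 1).factorial : ℝ) else 0

open Classical in
/-- The diagonal tensor of vertex degrees. -/
noncomputable def degTensor (H : Hypergraph V) (k : ℕ) : KTensor ℝ V k := fun i α =>
  if ∀ j, α j = i then (H.deg i : ℝ) else 0

/-- `𝒜_a(H) = a 𝒟(H) + (1 - a) 𝒜(H)`. -/
noncomputable def alphaTensor (H : Hypergraph V) (k : ℕ) (a : ℝ) : KTensor ℝ V k :=
  a • H.degTensor k + (1 - a) • H.adjTensor k

end Hypergraph

/-- A finite hypergraph whose vertices are exactly the elements of the finite type `V`. -/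
structure FinHypergraph where
  V : Type
  [fintypeV : Fintype V]
  [decEqV : DecidableEq V]
  graph : Hypergraph V
  vertexSet_eq : graph.vertexSet = Set.univ

namespace FinHypergraph

attribute [instance] FinHypergraph.fintypeV FinHypergraph.decEqV

/-- The `t`-th order `𝒜_a`-spectral moment `Tr_t(𝒜_a(H))` of a `k`-uniform hypergraph. -/
noncomputable def moment (k : ℕ) (a : ℝ) (H : FinHypergraph) (t : ℕ) : ℝ :=
  (H.graph.alphaTensor k a).trace t

/-- `H₁ ≺_a H₂` in the `S_a`-order of `k`-uniform hypergraphs with the same number `n` of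
vertices: lexicographic comparison of the moments of orders `0, 1, …, n(k-1)^{n-1} - 1`. -/
def SPrec (k : ℕ) (a : ℝ) (H₁ H₂ : FinHypergraph) : Prop :=
  Fintype.card H₁.V = Fintype.card H₂.V ∧
    ∃ d : ℕ, 1 ≤ d ∧ d ≤ Fintype.card H₁.V * (k - 1) ^ (Fintype.card H₁.V - 1) - 1 ∧
      (∀ t < d, moment k a H₁ t = moment k a H₂ t) ∧ moment k a H₁ d < moment k a H₂ d

/-- Isomorphism of hypergraphs. -/
def Iso (H₁ H₂ : FinHypergraph) : Prop :=
  ∃ σ : H₁.V ≃ H₂.V, H₁.graph.image σ = H₂.graph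

/-- `H` is, up to isomorphism, the last member of the class `P` in the `S_a`-order: every
other member comes strictly before it. -/
def IsLast (k : ℕ) (a : ℝ) (P : FinHypergraph → Prop) (H : FinHypergraph) : Prop :=
  P H ∧ ∀ T, P T → ¬ Iso T H → SPrec k a T H

/-- `H` is, up to isomorphism, the second last member of the class `P`: the class has a last
member `L`, and `H` is the last among the members not isomorphic to `L`. -/
def IsSecondLast (k : ℕ) (a : ℝ) (P : FinHypergraph → Prop) (H : FinHypergraph) : Prop :=
  ∃ L, IsLast k a P L ∧ IsLast k a (fun T => P T ∧ ¬ Iso T L) H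

/-- The `k`-uniform hypertrees with `m` hyperedges. -/
def IsUniformHypertree (k m : ℕ) (T : FinHypergraph) : Prop :=
  T.graph.IsUniform k ∧ T.graph.IsHypertree ∧ T.graph.edgeSet.ncard = m

/-- The vertex set of a starlike hypertree with `r` legs of lengths `ℓ 0, …, ℓ (r - 1)`: the
common vertex `none`, and the further vertices of the legs. -/
abbrev StarlikeVertex (k : ℕ) {r : ℕ} (ℓ : Fin r → ℕ) : Type :=
  Option (Σ i : Fin r, Fin (ℓ i * (k - 1)))

/-- `AtPosition i p x` says that `x` is the `p`-th vertex along leg `i`, counted from the common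
vertex, which is at position `0` on every leg. -/
def AtPosition {k r : ℕ} {ℓ : Fin r → ℕ} (i : Fin r) (p : ℕ) : StarlikeVertex k ℓ → Prop
  | none => p = 0
  | some y => y.1 = i ∧ p = y.2.val + 1

/-- The starlike hypertree `S^{(k)}_{ℓ 0, …, ℓ (r - 1)}`: hyperpaths of lengths `ℓ 0, …, ℓ (r - 1)`
sharing a common end vertex. The hyperpath of length `ℓ i` has vertices `0, …, (ℓ i)(k-1)`, and its
`j`-th hyperedge consists of the vertices `j(k-1), …, (j+1)(k-1)`, for `j < ℓ i`. -/
def starlike (k : ℕ) {r : ℕ} (ℓ : Fin r → ℕ) : FinHypergraph where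
  V := StarlikeVertex k ℓ
  graph :=
    { vertexSet := Set.univ
      edgeSet := {e | ∃ i : Fin r, ∃ j < ℓ i,
        e = {x | ∃ p, j * (k - 1) ≤ p ∧ p ≤ (j + 1) * (k - 1) ∧ AtPosition i p x}}
      subset_vertexSet_of_mem_edgeSet' := fun _ _ => Set.subset_univ _ }
  vertexSet_eq := rfl

end FinHypergraph

/-!
The operators in `Tr_d` differentiate in the rows of at most `d` vertices, and a closed walk in the
auxiliary matrix enters no row that it does not leave. Hence `Tr_d` only sees the tensor entries
with at most `d` distinct indices. For a `k`-uniform hypergraph and `d < k` only the diagonal of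
`𝒜_a` is left, and `Tr_d(𝒜_a) = (k-1)^{n-1} ∑_v (a deg v)^d`; for `k = 2` the trace is the usual
`tr(M^d)`, which for `d = 2` adds a term depending on `∑_v deg v` only. A hypertree with `m`
hyperedges has `m(k-1) + 1` vertices and degree sum `mk`, so two of them agree in `Tr_0` and `Tr_1`,
and `Tr_2` orders them by the sum of the squares of the degrees.

The star is the only hypertree with a vertex of degree `m`, and `S_{1,2,1,…,1}` the only one with a
vertex of degree `m - 1`. Convexity bounds the sum of squares from above in terms of the largest
degree, and from below in terms of the degree of any one vertex; as the number of vertices and the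
degree sum are fixed, these bounds separate hypertrees by their largest degree near the top.
-/

/-! ### Locality of traces -/

namespace KTensor

open MvPolynomial

section Polynomials

variable {σ R : Type*} [CommRing R]

/-- The substitution that sets every variable outside `S` to `0`. -/
noncomputable def restrictVars (S : Set σ) : MvPolynomial σ R →ₐ[R] MvPolynomial σ R :=
  aeval (S.indicator X)

theorem constantCoeff_restrictVars (S : Set σ) (P : MvPolynomial σ R) :
    constantCoeff (restrictVars S P) = constantCoeff P := by
  induction P using MvPolynomial.induction_on with
  | C r => simp [restrictVars]
  | add P Q hP hQ => simp only [map_add, hP, hQ]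
  | mul_X P p _ => by_cases hp : p ∈ S <;> simp [restrictVars, hp]

open Classical in
theorem pderiv_restrictVars (S : Set σ) (p : σ) (P : MvPolynomial σ R) :
    pderiv p (restrictVars S P) = if p ∈ S then restrictVars S (pderiv p P) else 0 := by
  have restrictVars_X (q : σ) : restrictVars S (X q : MvPolynomial σ R) =
      if q ∈ S then X q else 0 := by simp [restrictVars, Set.indicator_apply]
  induction P using MvPolynomial.induction_on with
  | C r => simp [restrictVars]
  | add P Q hP hQ => rw [map_add, map_add, hP, hQ]; split_ifs <;> simp
  | mul_X P q hP =>
    rcases eq_or_ne q p with rfl | hqp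
    · by_cases hq : q ∈ S <;> simp [hP, hq, restrictVars_X]
    · by_cases hq : q ∈ S <;> by_cases hp : p ∈ S <;>
        simp [hP, hq, hp, restrictVars_X, pderiv_X_of_ne hqp]

open Classical in
theorem prod_pderiv_restrictVars (S : Set σ) (l : List σ) (P : MvPolynomial σ R) :
    (l.map fun p => (pderiv (R := R) p).toLinearMap).prod (restrictVars S P) =
      if ∀ p ∈ l, p ∈ S then
        restrictVars S ((l.map fun p => (pderiv (R := R) p).toLinearMap).prod P) else 0 := by
  induction l with
  | nil => simp
  | cons p l ih =>
    simp only [List.map_cons, List.prod_cons, Module.End.mul_apply, ih, List.forall_mem_cons]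
    by_cases hl : ∀ q ∈ l, q ∈ S
    · simp only [if_pos hl, Derivation.coeFn_coe, pderiv_restrictVars, and_iff_left hl]
    · rw [if_neg hl, if_neg fun h => hl h.2, map_zero]

theorem restrictVars_rows_trace_mvPolynomialX_pow {V : Type*} [Fintype V] [DecidableEq V]
    (s : Set V) (N : ℕ) :
    restrictVars (s ×ˢ Set.univ) (Matrix.trace (Matrix.mvPolynomialX V V R ^ N)) =
      restrictVars (s ×ˢ s) (Matrix.trace (Matrix.mvPolynomialX V V R ^ N)) := by
  classical
  -- Both are traces of powers of `E * X` and `E * X * E`, with `E` the projection onto `s`.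
  let E : Matrix V V (MvPolynomial (V × V) R) := Matrix.diagonal (s.indicator 1)
  have map_trace_pow (S : Set (V × V)) :
      restrictVars S (Matrix.trace (Matrix.mvPolynomialX V V R ^ N)) =
        Matrix.trace (((Matrix.mvPolynomialX V V R).map (restrictVars S)) ^ N) := by
    rw [AddMonoidHom.map_trace, ← AlgHom.mapMatrix_apply, ← AlgHom.mapMatrix_apply, map_pow]
  have rows : (Matrix.mvPolynomialX V V R).map (restrictVars (s ×ˢ Set.univ)) =
      E * Matrix.mvPolynomialX V V R := by
    ext1 i j
    by_cases hi : i ∈ s <;> simp [E, restrictVars, hi]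
  have block : (Matrix.mvPolynomialX V V R).map (restrictVars (s ×ˢ s)) =
      E * Matrix.mvPolynomialX V V R * E := by
    ext1 i j
    by_cases hi : i ∈ s <;> by_cases hj : j ∈ s <;> simp [E, restrictVars, hi, hj]
  have idem : E * E = E := by
    simp only [E, Matrix.diagonal_mul_diagonal]
    congr 1
    ext1 i
    by_cases hi : i ∈ s <;> simp [hi]
  rw [map_trace_pow, map_trace_pow, rows, block]
  have pow_block (n : ℕ) : (E * Matrix.mvPolynomialX V V R * E) ^ (n + 1) =
      (E * Matrix.mvPolynomialX V V R) ^ (n + 1) * E := by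
    induction n with
    | zero => rw [zero_add, pow_one, pow_one]
    | succ n ih =>
      rw [pow_succ, ih, pow_succ _ (n + 1)]
      simp only [← mul_assoc, mul_assoc _ E E, idem]
  cases N with
  | zero => rw [pow_zero, pow_zero]
  | succ N =>
    rw [pow_block, Matrix.trace_mul_comm, pow_succ']
    simp only [← mul_assoc, idem]

theorem pderiv_pow_X_pow (p : σ) (n : ℕ) :
    ((pderiv (R := R) p).toLinearMap ^ n) (X p ^ n) = (n.factorial : MvPolynomial σ R) := by
  induction n with
  | zero => simp
  | succ n ih =>
    have deriv_X_pow : pderiv p (X p ^ (n + 1) : MvPolynomial σ R) = (n + 1) • X p ^ n := by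
      simp
    rw [pow_succ, Module.End.mul_apply, Derivation.coeFn_coe, deriv_X_pow, map_nsmul, ih,
      Nat.factorial_succ, nsmul_eq_mul, Nat.cast_mul]

theorem constantCoeff_sum_smul_pderiv_pow [Fintype σ] (x : σ → R) {d : ℕ} {P : MvPolynomial σ R}
    (hP : P.IsHomogeneous d) :
    constantCoeff (((∑ p, x p • (pderiv (R := R) p).toLinearMap :
      Module.End R (MvPolynomial σ R)) ^ d) P) = d.factorial * eval x P := by
  induction d generalizing P with
  | zero =>
    rw [totalDegree_eq_zero_iff_eq_C.mp ((totalDegree_zero_iff_isHomogeneous _).mpr hP)]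
    simp
  | succ d ih =>
    set D : Module.End R (MvPolynomial σ R) := ∑ p, x p • (pderiv (R := R) p).toLinearMap
    have D_apply : D P = ∑ p, x p • pderiv p P := by simp [D]
    have homogeneous : (D P).IsHomogeneous d := by
      rw [D_apply]
      exact IsHomogeneous.sum _ _ _ fun p _ => (homogeneousSubmodule σ R d).smul_mem _ hP.pderiv
    have euler : eval x (D P) = (d + 1 : ℕ) * eval x P := by
      have := congrArg (eval x) hP.sum_X_mul_pderiv
      simpa [D_apply] using this
    rw [pow_succ, Module.End.mul_apply, ih homogeneous, euler, Nat.factorial_succ]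
    push_cast
    ring

theorem isHomogeneous_trace_mvPolynomialX_pow {V : Type*} [Fintype V] [DecidableEq V] (N : ℕ) :
    (Matrix.trace (Matrix.mvPolynomialX V V R ^ N)).IsHomogeneous N := by
  have entry (i j : V) : ((Matrix.mvPolynomialX V V R ^ N) i j).IsHomogeneous N := by
    induction N generalizing j with
    | zero =>
      rw [pow_zero, Matrix.one_apply]
      split_ifs
      exacts [isHomogeneous_one _ _, isHomogeneous_zero _ _ _]
    | succ N ih =>
      rw [pow_succ, Matrix.mul_apply]
      exact IsHomogeneous.sum _ _ _ fun l _ => (ih l).mul (isHomogeneous_X _ _)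
  exact IsHomogeneous.sum _ _ _ fun i _ => entry i i

end Polynomials

variable {V R : Type*} [Field R] {k : ℕ}

open Classical in
/-- The tensor obtained from `A` by keeping only the entries `A i α` all of whose pairs `(i, α j)`
lie in `S`, that is, those whose differential operator involves only variables in `S`. -/
noncomputable def restrict (A : KTensor R V k) (S : Set (V × V)) : KTensor R V k :=
  fun i α => if ∀ j, (i, α j) ∈ S then A i α else 0

theorem noncommProd_semiconjBy {ι M : Type*} [Monoid M] (s : Finset ι) (f g : ι → M) (hf hg)
    (a : M) (h : ∀ i ∈ s, SemiconjBy a (f i) (g i)) :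
    SemiconjBy a (s.noncommProd f hf) (s.noncommProd g hg) := by
  classical
  induction s using Finset.induction_on with
  | empty => simp
  | insert i s hi ih =>
    rw [Finset.noncommProd_insert_of_notMem _ _ _ _ hi,
      Finset.noncommProd_insert_of_notMem _ _ _ _ hi]
    exact (h i (Finset.mem_insert_self i s)).mul_right
      (ih _ _ fun j hj => h j (Finset.mem_insert_of_mem hj))

variable [Fintype V]

theorem restrictVars_semiconjBy_rowOp (A : KTensor R V k) (S : Set (V × V)) (i : V) :
    SemiconjBy (restrictVars S).toLinearMap (rowOp (A.restrict S) i) (rowOp A i) := by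
  classical
  have partialOp_apply (α : Fin (k - 1) → V) (P : MvPolynomial (V × V) R) :
      partialOp R i α (restrictVars S P) =
        if ∀ j, (i, α j) ∈ S then restrictVars S (partialOp R i α P) else 0 := by
    have := prod_pderiv_restrictVars S (List.ofFn fun j => (i, α j)) P
    simp only [List.map_ofFn, List.forall_mem_ofFn_iff] at this
    exact this
  refine LinearMap.ext fun P => ?_
  simp only [Module.End.mul_apply, AlgHom.toLinearMap_apply, rowOp, LinearMap.sum_apply,
    LinearMap.smul_apply, map_sum, map_smul]
  refine Finset.sum_congr rfl fun α _ => ?_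
  rw [partialOp_apply, restrict]
  split_ifs
  · rfl
  · rw [zero_smul, smul_zero]

/-- The differential operator `∏ᵢ (∑_α A_{iα} ∂/∂a_{iα}) ^ cᵢ`. -/
noncomputable def rowsOp (A : KTensor R V k) (c : V → ℕ) :
    Module.End R (MvPolynomial (V × V) R) :=
  Finset.univ.noncommProd (fun i => rowOp A i ^ c i) (rowOp_pow_pairwise A c)

theorem rowsOp_congr {A B : KTensor R V k} {c : V → ℕ} (h : ∀ i, c i ≠ 0 → A i = B i) :
    rowsOp A c = rowsOp B c := by
  refine Finset.noncommProd_congr rfl (fun i _ => ?_) _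
  rcases eq_or_ne (c i) 0 with hi | hi
  · rw [hi, pow_zero, pow_zero]
  · rw [rowOp, rowOp, h i hi]

theorem constantCoeff_rowsOp_restrict (A : KTensor R V k) (S : Set (V × V)) (c : V → ℕ)
    (P : MvPolynomial (V × V) R) :
    constantCoeff (rowsOp (A.restrict S) c P) = constantCoeff (rowsOp A c (restrictVars S P)) := by
  have h : SemiconjBy (restrictVars S).toLinearMap (rowsOp (A.restrict S) c) (rowsOp A c) :=
    noncommProd_semiconjBy _ _ _ _ _ _ fun i _ => (restrictVars_semiconjBy_rowOp A S i).pow_right _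
  exact (constantCoeff_restrictVars S _).symm.trans
    (congrArg constantCoeff (LinearMap.congr_fun h P))

variable [DecidableEq V]

theorem trace_eq_sum_rowsOp (A : KTensor R V k) (d : ℕ) :
    A.trace d = ((k - 1 : ℕ) : R) ^ (Fintype.card V - 1) *
      ∑ c ∈ Finset.piAntidiag (Finset.univ : Finset V) d,
        (∏ i, (1 / ((c i * (k - 1)).factorial : R))) *
          constantCoeff
            (rowsOp A c (Matrix.trace (Matrix.mvPolynomialX V V R ^ (d * (k - 1))))) :=
  rfl

theorem constantCoeff_rowsOp_trace_eq_restrict (A : KTensor R V k) (c : V → ℕ) (N : ℕ) :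
    constantCoeff (rowsOp A c (Matrix.trace (Matrix.mvPolynomialX V V R ^ N))) =
      constantCoeff (rowsOp (A.restrict (c.support ×ˢ c.support)) c
        (Matrix.trace (Matrix.mvPolynomialX V V R ^ N))) := by
  have rows : rowsOp A c = rowsOp (A.restrict (c.support ×ˢ Set.univ)) c :=
    rowsOp_congr fun i hi => by
      funext α
      simp only [restrict, Set.mem_prod, Function.mem_support, ne_eq, hi, not_false_eq_true,
        Set.mem_univ, and_self, implies_true, if_true]
  rw [rows, constantCoeff_rowsOp_restrict, restrictVars_rows_trace_mvPolynomialX_pow,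
    ← constantCoeff_rowsOp_restrict]

theorem ncard_support_le_of_mem_piAntidiag {c : V → ℕ} {d : ℕ}
    (hc : c ∈ Finset.piAntidiag (Finset.univ : Finset V) d) : c.support.ncard ≤ d := by
  rw [Finset.mem_piAntidiag] at hc
  classical
  have : c.support = ((Finset.univ.filter fun i => c i ≠ 0 : Finset V) : Set V) := by ext; simp
  rw [this, Set.ncard_coe_finset, ← hc.1, Finset.card_eq_sum_ones, Finset.sum_filter]
  exact Finset.sum_le_sum fun i _ => by split_ifs <;> omega

theorem trace_congr_of_ncard_le {A B : KTensor R V k} {d : ℕ}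
    (h : ∀ i α, (insert i (Set.range α)).ncard ≤ d → A i α = B i α) : A.trace d = B.trace d := by
  rw [trace_eq_sum_rowsOp, trace_eq_sum_rowsOp]
  congr 1
  refine Finset.sum_congr rfl fun c hc => ?_
  rw [constantCoeff_rowsOp_trace_eq_restrict A, constantCoeff_rowsOp_trace_eq_restrict B]
  have agree (i : V) (hi : c i ≠ 0) : A.restrict (c.support ×ˢ c.support) i =
      B.restrict (c.support ×ˢ c.support) i := by
    funext α
    rw [restrict, restrict]
    split_ifs with hα
    · have subset : insert i (Set.range α) ⊆ c.support :=
        Set.insert_subset hi (Set.range_subset_iff.mpr fun j => (hα j).2)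
      exact h i α ((Set.ncard_le_ncard subset).trans (ncard_support_le_of_mem_piAntidiag hc))
    · rfl
  rw [rowsOp_congr agree]

/-! ### Traces of diagonal tensors -/

omit [Fintype V] [DecidableEq V] in
theorem partialOp_const (i : V) :
    partialOp R i (fun _ : Fin (k - 1) => i) =
      (pderiv (R := R) (i, i)).toLinearMap ^ (k - 1) := by
  rw [partialOp, List.ofFn_const, List.prod_replicate]

omit [DecidableEq V] in
theorem rowOp_restrict_diagonal (A : KTensor R V k) (i : V) :
    rowOp (A.restrict (Set.diagonal V)) i =
      A i (fun _ => i) • (pderiv (R := R) (i, i)).toLinearMap ^ (k - 1) := by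
  rw [rowOp, Finset.sum_eq_single fun _ => i]
  · rw [partialOp_const, restrict, if_pos fun _ => Set.mem_diagonal i]
  · intro α _ hα
    rw [restrict, if_neg fun h => hα (funext fun j => (h j).symm), zero_smul]
  · exact fun h => absurd (Finset.mem_univ _) h

theorem rowsOp_single (A : KTensor R V k) (j : V) (d : ℕ) :
    rowsOp A (Pi.single j d) = rowOp A j ^ d := by
  have others : ∀ i ∈ Finset.univ.erase j, rowOp A i ^ (Pi.single j d : V → ℕ) i = 1 := by
    intro i hi
    rw [Pi.single_eq_of_ne (Finset.ne_of_mem_erase hi), pow_zero]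
  refine (Finset.noncommProd_erase_mul _ (Finset.mem_univ j) _ _).symm.trans ?_
  refine (congrArg₂ (· * ·) (Finset.noncommProd_eq_pow_card _ _ _ 1 others) rfl).trans ?_
  rw [one_pow, one_mul, Pi.single_eq_same]

omit [DecidableEq V] in
theorem rowsOp_apply_eq_zero {A : KTensor R V k} {c : V → ℕ} {i : V} (hi : c i ≠ 0)
    {P : MvPolynomial (V × V) R} (hP : rowOp A i P = 0) : rowsOp A c P = 0 := by
  classical
  obtain ⟨r, hr⟩ := Nat.exists_eq_succ_of_ne_zero hi
  rw [rowsOp, ← Finset.noncommProd_erase_mul _ (Finset.mem_univ i), hr, pow_succ,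
    Module.End.mul_apply, Module.End.mul_apply, hP, map_zero, map_zero]

theorem restrictVars_diagonal_trace_mvPolynomialX_pow (N : ℕ) :
    restrictVars (Set.diagonal V) (Matrix.trace (Matrix.mvPolynomialX V V R ^ N)) =
      ∑ j, (X (j, j) : MvPolynomial (V × V) R) ^ N := by
  have diagonal : (Matrix.mvPolynomialX V V R).map (restrictVars (Set.diagonal V)) =
      Matrix.diagonal fun j => X (j, j) := by
    ext1 i j
    rcases eq_or_ne i j with rfl | hij
    · simp [restrictVars]
    · simp [restrictVars, hij]
  rw [AddMonoidHom.map_trace, ← AlgHom.mapMatrix_apply, map_pow, AlgHom.mapMatrix_apply, diagonal,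
    Matrix.diagonal_pow, Matrix.trace_diagonal]
  rfl

theorem constantCoeff_rowsOp_restrict_diagonal_X_pow (hk : 2 ≤ k) (A : KTensor R V k)
    {c : V → ℕ} {d : ℕ} (hc : c ∈ Finset.piAntidiag Finset.univ d) (j : V) :
    constantCoeff (rowsOp (A.restrict (Set.diagonal V)) c (X (j, j) ^ (d * (k - 1)))) =
      if c = Pi.single j d then A j (fun _ => j) ^ d * ((d * (k - 1)).factorial : R) else 0 := by
  split_ifs with h
  · rw [h, rowsOp_single, rowOp_restrict_diagonal, smul_pow, ← pow_mul, mul_comm (k - 1),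
      LinearMap.smul_apply, pderiv_pow_X_pow, constantCoeff_smul, smul_eq_mul, map_natCast]
  · obtain ⟨i, hij, hi⟩ : ∃ i, i ≠ j ∧ c i ≠ 0 := by
      by_contra! hsupp
      have hcj : c = Pi.single j (c j) := by
        funext i
        rcases eq_or_ne i j with rfl | hij
        · rw [Pi.single_eq_same]
        · rw [Pi.single_eq_of_ne hij, hsupp i hij]
      have hsum := (Finset.mem_piAntidiag.mp hc).1
      rw [hcj, Finset.sum_pi_single', if_pos (Finset.mem_univ j)] at hsum
      exact h (hsum ▸ hcj)
    have pderiv_eq_zero :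
        pderiv (i, i) (X (j, j) ^ (d * (k - 1)) : MvPolynomial (V × V) R) = 0 := by
      rw [pderiv_pow, pderiv_X_of_ne (by simpa using hij.symm), mul_zero]
    have rowOp_eq_zero :
        rowOp (A.restrict (Set.diagonal V)) i (X (j, j) ^ (d * (k - 1))) = 0 := by
      obtain ⟨r, hr⟩ : ∃ r, k - 1 = r + 1 := ⟨k - 2, by omega⟩
      rw [rowOp_restrict_diagonal, LinearMap.smul_apply]
      conv_lhs => enter [2, 1]; rw [hr, pow_succ]
      rw [Module.End.mul_apply, Derivation.coeFn_coe, pderiv_eq_zero, map_zero, smul_zero]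
    rw [rowsOp_apply_eq_zero hi rowOp_eq_zero, map_zero]

theorem trace_restrict_diagonal [CharZero R] (hk : 2 ≤ k) (A : KTensor R V k) (d : ℕ) :
    (A.restrict (Set.diagonal V)).trace d =
      ((k - 1 : ℕ) : R) ^ (Fintype.card V - 1) * ∑ i, A i (fun _ => i) ^ d := by
  have restrict_restrict :
      (A.restrict (Set.diagonal V)).restrict (Set.diagonal V) = A.restrict (Set.diagonal V) := by
    funext i α
    rw [restrict, restrict]
    split_ifs <;> rfl
  have term (c : V → ℕ) (hc : c ∈ Finset.piAntidiag Finset.univ d) :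
      constantCoeff (rowsOp (A.restrict (Set.diagonal V)) c
        (Matrix.trace (Matrix.mvPolynomialX V V R ^ (d * (k - 1))))) =
      ∑ j, if c = Pi.single j d then A j (fun _ => j) ^ d * ((d * (k - 1)).factorial : R)
        else 0 := by
    rw [← restrict_restrict, constantCoeff_rowsOp_restrict,
      restrictVars_diagonal_trace_mvPolynomialX_pow, map_sum, map_sum]
    exact Finset.sum_congr rfl fun j _ =>
      constantCoeff_rowsOp_restrict_diagonal_X_pow hk A hc j
  rw [trace_eq_sum_rowsOp]
  congr 1
  rw [Finset.sum_congr rfl fun c hc => by rw [term c hc, Finset.mul_sum], Finset.sum_comm]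
  refine Finset.sum_congr rfl fun j _ => ?_
  rw [Finset.sum_eq_single (Pi.single j d)]
  · rw [if_pos rfl, Finset.prod_eq_single j]
    · rw [Pi.single_eq_same, mul_left_comm,
        one_div_mul_cancel (Nat.cast_ne_zero.mpr (Nat.factorial_ne_zero _)), mul_one]
    · intro i _ hij
      rw [Pi.single_eq_of_ne hij, zero_mul, Nat.factorial_zero, Nat.cast_one, one_div_one]
    · exact fun h => absurd (Finset.mem_univ j) h
  · exact fun c _ hc => by rw [if_neg hc, mul_zero]
  · exact fun h => absurd (by simp) h

/-! ### Traces of matrices -/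

omit [DecidableEq V] in
theorem sum_rowOp_of_order_two (A : KTensor R V 2) :
    ∑ i, rowOp A i = ∑ p : V × V, A p.1 (fun _ => p.2) • (pderiv (R := R) p).toLinearMap := by
  rw [Fintype.sum_prod_type]
  refine Finset.sum_congr rfl fun i _ => ?_
  have sum_const (f : (Fin (2 - 1) → V) → Module.End R (MvPolynomial (V × V) R)) :
      ∑ α, f α = ∑ j, f fun _ => j := ((Equiv.funUnique (Fin 1) V).symm.sum_comp f).symm
  rw [rowOp, sum_const]
  refine Finset.sum_congr rfl fun j _ => ?_
  rw [partialOp, List.ofFn_const, List.prod_replicate, pow_one]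

theorem trace_of_order_two [CharZero R] (A : KTensor R V 2) (d : ℕ) :
    A.trace d = Matrix.trace ((Matrix.of fun i j => A i fun _ => j) ^ d) := by
  set P := Matrix.trace (Matrix.mvPolynomialX V V R ^ d)
  have d_factorial_ne_zero : (d.factorial : R) ≠ 0 := Nat.cast_ne_zero.mpr d.factorial_ne_zero
  have term (c : V → ℕ) (hc : c ∈ Finset.piAntidiag Finset.univ d) :
      (d.factorial : R) * ∏ i, (1 / ((c i).factorial : R)) = Nat.multinomial Finset.univ c := by
    have spec := Nat.multinomial_spec Finset.univ c
    rw [(Finset.mem_piAntidiag.mp hc).1] at spec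
    rw [← spec, Nat.cast_mul, Nat.cast_prod, mul_right_comm, ← Finset.prod_mul_distrib,
      Finset.prod_eq_one fun i _ => mul_one_div_cancel
        (Nat.cast_ne_zero.mpr (c i).factorial_ne_zero), one_mul]
  have euler := constantCoeff_sum_smul_pderiv_pow (fun p : V × V => A p.1 fun _ => p.2)
    (isHomogeneous_trace_mvPolynomialX_pow d)
  have eval_P : eval (fun p : V × V => A p.1 fun _ => p.2) P =
      Matrix.trace ((Matrix.of fun i j => A i fun _ => j) ^ d) := by
    rw [AddMonoidHom.map_trace, ← RingHom.mapMatrix_apply, map_pow]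
    exact congrArg (fun M => Matrix.trace (M ^ d))
      (Matrix.mvPolynomialX_mapMatrix_eval (Matrix.of fun i j => A i fun _ => j))
  rw [← sum_rowOp_of_order_two, Finset.sum_pow_eq_sum_piAntidiag_of_commute _ _
    fun i _ j _ _ => rowOp_commute A i j, eval_P] at euler
  rw [← mul_right_inj' d_factorial_ne_zero, ← euler, trace_eq_sum_rowsOp, LinearMap.sum_apply,
    map_sum]
  simp only [Nat.add_one_sub_one, Nat.cast_one, one_pow, one_mul, mul_one]
  rw [Finset.mul_sum]
  refine Finset.sum_congr rfl fun c hc => ?_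
  rw [← mul_assoc, term c hc, Module.End.mul_apply, Module.End.natCast_apply, map_nsmul,
    nsmul_eq_mul, rowsOp]

/-! ### Traces of the tensor `𝒜_a` of a uniform hypergraph -/

section AlphaTensor

variable {V : Type*} {k : ℕ} {H : Hypergraph V}

theorem adjTensor_eq_zero_of_ncard_lt (hH : H.IsUniform k) {i : V} {α : Fin (k - 1) → V}
    (h : (insert i (Set.range α)).ncard < k) : H.adjTensor k i α = 0 := by
  rw [Hypergraph.adjTensor, if_neg]
  intro he
  rw [Set.ncard, hH _ he, ENat.toNat_natCast] at h
  exact h.false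

theorem alphaTensor_const (hk : 2 ≤ k) (hH : H.IsUniform k) (a : ℝ) (i : V) :
    H.alphaTensor k a i (fun _ => i) = a * H.deg i := by
  have small : (insert i (Set.range fun _ : Fin (k - 1) => i)).ncard < k := by
    have : Nonempty (Fin (k - 1)) := ⟨⟨0, by omega⟩⟩
    rw [Set.range_const, Set.pair_eq_singleton, Set.ncard_singleton]
    exact hk
  simp [Hypergraph.alphaTensor, adjTensor_eq_zero_of_ncard_lt hH small, Hypergraph.degTensor]

theorem sum_pair_mem_edgeSet [Fintype V] [DecidablePred (· ∈ H.edgeSet)] (hH : H.IsUniform 2)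
    (i : V) : ∑ j, (if {i, j} ∈ H.edgeSet then (1 : ℝ) else 0) = H.deg i := by
  have edges_eq : {e | e ∈ H.edgeSet ∧ i ∈ e} =
      (fun j => ({i, j} : Set V)) '' {j | {i, j} ∈ H.edgeSet} := by
    ext e
    constructor
    · rintro ⟨he, hi⟩
      obtain ⟨x, y, hxy, rfl⟩ := Set.encard_eq_two.mp (hH e he)
      rcases hi with rfl | rfl
      · exact ⟨y, he, rfl⟩
      · exact ⟨x, by rwa [Set.mem_ofPred_eq, Set.pair_comm], Set.pair_comm _ _⟩
    · rintro ⟨j, hj, rfl⟩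
      exact ⟨hj, Set.mem_insert _ _⟩
  have injOn : Set.InjOn (fun j => ({i, j} : Set V)) {j | {i, j} ∈ H.edgeSet} := by
    intro x _ y _ hxy
    rcases Set.pair_eq_pair_iff.mp hxy with ⟨-, h⟩ | ⟨h₁, h₂⟩
    exacts [h, h₂.trans h₁]
  rw [Hypergraph.deg, edges_eq, injOn.ncard_image, Finset.sum_boole, Set.ncard_eq_toFinset_card']
  simp

variable [Fintype V] [DecidableEq V]

theorem trace_alphaTensor_of_lt (hk : 2 ≤ k) (hH : H.IsUniform k) (a : ℝ) {d : ℕ} (hd : d < k) :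
    (H.alphaTensor k a).trace d =
      ((k - 1 : ℕ) : ℝ) ^ (Fintype.card V - 1) * ∑ i, (a * (H.deg i : ℝ)) ^ d := by
  have diagonal : (H.alphaTensor k a).trace d =
      ((H.alphaTensor k a).restrict (Set.diagonal V)).trace d := by
    refine trace_congr_of_ncard_le fun i α h => ?_
    rw [restrict]
    split_ifs with hα
    · rfl
    · have not_const : ¬ ∀ j, α j = i := fun h' => hα fun j => (h' j).symm
      simp [Hypergraph.alphaTensor, adjTensor_eq_zero_of_ncard_lt hH (h.trans_lt hd),
        Hypergraph.degTensor, not_const]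
  rw [diagonal, trace_restrict_diagonal hk]
  simp only [alphaTensor_const hk hH]

theorem trace_alphaTensor_two_of_order_two (hH : H.IsUniform 2) (a : ℝ) :
    (H.alphaTensor 2 a).trace 2 =
      a ^ 2 * ∑ i, (H.deg i : ℝ) ^ 2 + (1 - a) ^ 2 * ∑ i, (H.deg i : ℝ) := by
  classical
  have off_diagonal {i j : V} (hij : i ≠ j) : H.alphaTensor 2 a i (fun _ => j) =
      (1 - a) * if {i, j} ∈ H.edgeSet then 1 else 0 := by
    simp [Hypergraph.alphaTensor, Hypergraph.adjTensor, Hypergraph.degTensor, hij.symm,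
      Set.range_const]
  have term (i j : V) :
      H.alphaTensor 2 a i (fun _ => j) * H.alphaTensor 2 a j (fun _ => i) =
        (if i = j then a ^ 2 * (H.deg i : ℝ) ^ 2 else 0) +
          (1 - a) ^ 2 * if {i, j} ∈ H.edgeSet then 1 else 0 := by
    rcases eq_or_ne i j with rfl | hij
    · have not_edge : {i, i} ∉ H.edgeSet := fun h => by
        have := hH _ h
        rw [Set.pair_eq_singleton, Set.encard_singleton] at this
        exact absurd this (by decide)
      rw [alphaTensor_const le_rfl hH, if_pos rfl, if_neg not_edge]
      ring
    · rw [off_diagonal hij, off_diagonal hij.symm, Set.pair_comm j i, if_neg hij]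
      split_ifs <;> ring
  rw [trace_of_order_two, pow_two, Matrix.trace]
  simp only [Matrix.diag_apply, Matrix.mul_apply, Matrix.of_apply, term, Finset.sum_add_distrib,
    Finset.sum_ite_eq, Finset.mem_univ, if_true, ← Finset.mul_sum, sum_pair_mem_edgeSet hH]

theorem trace_alphaTensor_one (hk : 2 ≤ k) (hH : H.IsUniform k) (a : ℝ) :
    (H.alphaTensor k a).trace 1 =
      ((k - 1 : ℕ) : ℝ) ^ (Fintype.card V - 1) * (a * ∑ i, (H.deg i : ℝ)) := by
  simp only [trace_alphaTensor_of_lt hk hH a hk, pow_one, Finset.mul_sum]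

theorem trace_alphaTensor_two (hk : 2 ≤ k) (hH : H.IsUniform k) (a : ℝ) :
    (H.alphaTensor k a).trace 2 = ((k - 1 : ℕ) : ℝ) ^ (Fintype.card V - 1) *
      (a ^ 2 * ∑ i, (H.deg i : ℝ) ^ 2 +
        if k = 2 then (1 - a) ^ 2 * ∑ i, (H.deg i : ℝ) else 0) := by
  rcases hk.eq_or_lt with rfl | hk'
  · simp [trace_alphaTensor_two_of_order_two hH]
  · rw [trace_alphaTensor_of_lt hk hH a hk', if_neg hk'.ne', add_zero]
    simp only [mul_pow, Finset.mul_sum]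

end AlphaTensor

end KTensor

/-! ### Counting vertices of hypertrees -/

/-- The bipartite graph that joins a vertex of `H` to the hyperedges containing it. It turns
hypertrees into trees, whose vertices and edges can be counted. -/
def incidenceGraph {V : Type*} (H : Hypergraph V) : SimpleGraph (V ⊕ H.edgeSet) where
  Adj
    | .inl v, .inr e => v ∈ e.1
    | .inr e, .inl v => v ∈ e.1
    | _, _ => False
  symm := ⟨by rintro (v | e) (w | f) h <;> exact h⟩
  loopless := ⟨by rintro (v | e) h <;> exact h⟩

namespace incidenceGraph

variable {V : Type*} {H : Hypergraph V}

@[simp]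
theorem adj_inl_inr {v : V} {e : H.edgeSet} :
    (incidenceGraph H).Adj (.inl v) (.inr e) ↔ v ∈ e.1 := Iff.rfl

@[simp]
theorem adj_inr_inl {v : V} {e : H.edgeSet} :
    (incidenceGraph H).Adj (.inr e) (.inl v) ↔ v ∈ e.1 := Iff.rfl

@[simp]
theorem not_adj_inl_inl {v w : V} : ¬ (incidenceGraph H).Adj (.inl v) (.inl w) := id

@[simp]
theorem not_adj_inr_inr {e f : H.edgeSet} : ¬ (incidenceGraph H).Adj (.inr e) (.inr f) := id

/-- The two-colouring of the incidence graph that separates vertices from hyperedges. -/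
def coloring (H : Hypergraph V) : (incidenceGraph H).Coloring Bool :=
  SimpleGraph.Coloring.mk Sum.isLeft <| by rintro (v | e) (w | f) h <;> simp_all

theorem isLeft_getVert {v : V} {y : V ⊕ H.edgeSet} (c : (incidenceGraph H).Walk (.inl v) y) {i : ℕ}
    (hi : i ≤ c.length) : (c.getVert i).isLeft ↔ Even i := by
  have := (coloring H).even_length_iff_congr (c.take i)
  rw [SimpleGraph.Walk.take_length, min_eq_left hi] at this
  exact ⟨fun h => this.mpr ⟨fun _ => h, fun _ => rfl⟩, fun h => (this.mp h).mp rfl⟩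

theorem connected (hH : H.IsConnected) (hV : H.vertexSet = Set.univ)
    (hne : ∀ e ∈ H.edgeSet, e.Nonempty) : (incidenceGraph H).Connected := by
  have reachable_vertices (u v : V) : (incidenceGraph H).Reachable (.inl u) (.inl v) := by
    induction hH.2 u (hV ▸ Set.mem_univ u) v (hV ▸ Set.mem_univ v) with
    | refl => exact SimpleGraph.Reachable.refl _
    | tail _ hadj ih =>
      obtain ⟨e, he, hb, hc⟩ := hadj
      exact ih.trans ((adj_inl_inr (e := ⟨e, he⟩).mpr hb).reachable.trans
        (adj_inr_inl.mpr hc).reachable)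
  have reachable_vertex (x : V ⊕ H.edgeSet) : ∃ v : V, (incidenceGraph H).Reachable x (.inl v) := by
    rcases x with v | ⟨e, he⟩
    · exact ⟨v, SimpleGraph.Reachable.refl _⟩
    · obtain ⟨v, hv⟩ := hne e he
      exact ⟨v, (adj_inr_inl.mpr hv).reachable⟩
  obtain ⟨v₀, -⟩ := hH.1
  have : Nonempty (V ⊕ H.edgeSet) := ⟨.inl v₀⟩
  refine SimpleGraph.Connected.mk fun x y => ?_
  obtain ⟨u, hu⟩ := reachable_vertex x
  obtain ⟨v, hv⟩ := reachable_vertex y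
  exact hu.trans ((reachable_vertices u v).trans hv.symm)

theorem val_finRotate {q : ℕ} (i : Fin q) : (finRotate q i).val = (i + 1) % q := by
  have := i.neZero
  rw [finRotate_apply, Fin.val_add, Fin.val_one', Nat.add_mod_mod]

theorem getVert_two_mul_finRotate {α : Type*} {G : SimpleGraph α} {v : α} (c : G.Walk v v) {q : ℕ}
    (hq : c.length = q + q) (i : Fin q) :
    c.getVert (2 * (finRotate q i).val) = c.getVert (2 * i + 2) := by
  rw [val_finRotate]
  rcases (show i.val + 1 ≤ q from i.2).lt_or_eq with h | h
  · rw [Nat.mod_eq_of_lt h, mul_add, mul_one]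
  · rw [h, Nat.mod_self, mul_zero, SimpleGraph.Walk.getVert_zero,
      show 2 * i.val + 2 = c.length by omega, SimpleGraph.Walk.getVert_length]

theorem exists_isCycle_of_isCycle {v : V} {c : (incidenceGraph H).Walk (.inl v) (.inl v)}
    (hc : c.IsCycle) : ∃ (q : ℕ) (x : Fin q → V) (e : Fin q → Set V), H.IsCycle x e := by
  obtain ⟨q, hq⟩ : Even c.length := by
    rw [← isLeft_getVert c le_rfl, SimpleGraph.Walk.getVert_length]
    rfl
  have three_le := hc.three_le_length
  have vertex (i : Fin q) : ∃ x : V, c.getVert (2 * i) = .inl x := by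
    rw [← Sum.isLeft_iff, isLeft_getVert c (by omega)]
    exact even_two_mul _
  have edge (i : Fin q) : ∃ e : H.edgeSet, c.getVert (2 * i + 1) = .inr e := by
    rw [← Sum.isRight_iff, ← Sum.not_isLeft, isLeft_getVert c (by omega), Nat.not_even_iff_odd]
    exact odd_two_mul_add_one _
  choose x hx using vertex
  choose e he using edge
  have getVert_inj {i j : ℕ} (hi : i ≤ c.length - 1) (hj : j ≤ c.length - 1)
      (h : c.getVert i = c.getVert j) : i = j := hc.getVert_injOn' hi hj h
  refine ⟨q, x, fun i => (e i).1, by omega, fun i j hij => ?_, fun i j hij => ?_,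
    fun i => ⟨(e i).2, ?_, ?_⟩⟩
  · have := getVert_inj (i := 2 * i) (j := 2 * j) (by omega) (by omega) (by rw [hx, hx, hij])
    omega
  · have := getVert_inj (i := 2 * i + 1) (j := 2 * j + 1) (by omega) (by omega)
      (by rw [he, he, Subtype.ext hij])
    omega
  · have := c.adj_getVert_succ (i := 2 * i) (by omega)
    rwa [hx, he] at this
  · have := c.adj_getVert_succ (i := 2 * i + 1) (by omega)
    rwa [he, ← getVert_two_mul_finRotate c hq, hx] at this

theorem isAcyclic (hH : ∀ (q : ℕ) (v : Fin q → V) (e : Fin q → Set V), ¬ H.IsCycle v e) :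
    (incidenceGraph H).IsAcyclic := by
  classical
  have no_cycle_at_vertex (v : V) (c : (incidenceGraph H).Walk (.inl v) (.inl v)) :
      ¬ c.IsCycle := fun hc => by
    obtain ⟨q, x, e, h⟩ := exists_isCycle_of_isCycle hc
    exact hH q x e h
  rintro (v | f) c hc
  · exact no_cycle_at_vertex v c hc
  · have snd_adj := c.adj_snd hc.not_nil
    have snd_mem : c.snd ∈ c.support := c.getVert_mem_support 1
    rcases h : c.snd with w | f'
    · rw [h] at snd_mem
      exact no_cycle_at_vertex w (c.rotate _ snd_mem) (hc.rotate snd_mem)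
    · rw [h] at snd_adj
      exact not_adj_inr_inr snd_adj

theorem isTree (hH : H.IsHypertree) (hV : H.vertexSet = Set.univ)
    (hne : ∀ e ∈ H.edgeSet, e.Nonempty) : (incidenceGraph H).IsTree :=
  ⟨connected hH.1 hV hne, isAcyclic hH.2⟩

section Counting

variable [Fintype V] [Fintype H.edgeSet] [DecidableRel (incidenceGraph H).Adj]

theorem degree_inl (v : V) : (incidenceGraph H).degree (.inl v) = H.deg v := by
  have neighbors : (incidenceGraph H).neighborSet (.inl v) =
      Sum.inr '' {e : H.edgeSet | v ∈ e.1} := by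
    ext (w | e) <;> simp
  have edges : {e | e ∈ H.edgeSet ∧ v ∈ e} = Subtype.val '' {e : H.edgeSet | v ∈ e.1} := by
    ext e
    simp [and_comm]
  rw [Hypergraph.deg, edges, Set.ncard_image_of_injective _ Subtype.val_injective,
    ← Set.ncard_image_of_injective _ Sum.inr_injective (β := V ⊕ H.edgeSet), ← neighbors,
    ← SimpleGraph.card_neighborSet_eq_degree, Set.ncard_eq_toFinset_card', Set.toFinset_card]

theorem degree_inr (e : H.edgeSet) : (incidenceGraph H).degree (.inr e) = e.1.ncard := by
  have neighbors : (incidenceGraph H).neighborSet (.inr e) = Sum.inl '' e.1 := by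
    ext (w | f) <;> simp
  rw [← Set.ncard_image_of_injective e.1 Sum.inl_injective (β := V ⊕ H.edgeSet), ← neighbors,
    ← SimpleGraph.card_neighborSet_eq_degree, Set.ncard_eq_toFinset_card', Set.toFinset_card]

variable (H) in
omit [DecidableRel (incidenceGraph H).Adj] in
theorem isBipartiteWith : (incidenceGraph H).IsBipartiteWith
    ((Finset.univ.map .inl : Finset (V ⊕ H.edgeSet)) : Set (V ⊕ H.edgeSet))
    (Finset.univ.map .inr : Finset (V ⊕ H.edgeSet)) := by
  constructor
  · rw [Finset.disjoint_coe, Finset.disjoint_left]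
    simp
  · rintro (v | e) (w | f) h <;> simp_all

variable (H) in
theorem card_edgeFinset_eq_sum_deg :
    (incidenceGraph H).edgeFinset.card = ∑ v, H.deg v := by
  classical
  rw [← SimpleGraph.isBipartiteWith_sum_degrees_eq_card_edges (isBipartiteWith H), Finset.sum_map]
  exact Finset.sum_congr rfl fun v _ => degree_inl v

variable (H) in
theorem card_edgeFinset_eq_sum_ncard :
    (incidenceGraph H).edgeFinset.card = ∑ e : H.edgeSet, e.1.ncard := by
  classical
  rw [← SimpleGraph.isBipartiteWith_sum_degrees_eq_card_edges' (isBipartiteWith H), Finset.sum_map]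
  exact Finset.sum_congr rfl fun e _ => degree_inr e

end Counting

end incidenceGraph

namespace FinHypergraph

variable {k m : ℕ} {T : FinHypergraph}

theorem IsUniformHypertree.ncard_edge (hT : IsUniformHypertree k m T) {e : Set T.V}
    (he : e ∈ T.graph.edgeSet) : e.ncard = k := by
  rw [Set.ncard, hT.1 e he, ENat.toNat_natCast]

theorem IsUniformHypertree.sum_deg (hT : IsUniformHypertree k m T) :
    ∑ v, T.graph.deg v = m * k := by
  classical
  let : Fintype T.graph.edgeSet := Fintype.ofFinite _
  rw [← incidenceGraph.card_edgeFinset_eq_sum_deg, incidenceGraph.card_edgeFinset_eq_sum_ncard,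
    Finset.sum_congr rfl fun e _ => hT.ncard_edge e.2, Finset.sum_const, Finset.card_univ,
    smul_eq_mul, ← Nat.card_eq_fintype_card, Nat.card_coe_set_eq, hT.2.2]

theorem IsUniformHypertree.card_add (hk : 1 ≤ k) (hT : IsUniformHypertree k m T) :
    Fintype.card T.V + m = m * k + 1 := by
  classical
  let : Fintype T.graph.edgeSet := Fintype.ofFinite _
  have tree := incidenceGraph.isTree hT.2.1 T.vertexSet_eq fun e he =>
    (Set.ncard_pos e.toFinite).mp (hT.ncard_edge he ▸ hk)
  rw [← hT.sum_deg, ← incidenceGraph.card_edgeFinset_eq_sum_deg, tree.card_edgeFinset,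
    Fintype.card_sum, ← Nat.card_eq_fintype_card (α := T.graph.edgeSet), Nat.card_coe_set_eq,
    hT.2.2]

theorem IsUniformHypertree.one_le_deg (hk : 2 ≤ k) (hm : 1 ≤ m) (hT : IsUniformHypertree k m T)
    (v : T.V) : 1 ≤ T.graph.deg v := by
  have one_lt_card : 1 < Fintype.card T.V := by
    have := hT.card_add (by omega)
    nlinarith
  obtain ⟨w, hw⟩ := Fintype.exists_ne_of_one_lt_card one_lt_card v
  have walk := hT.2.1.1.2 v (T.vertexSet_eq ▸ Set.mem_univ v) w (T.vertexSet_eq ▸ Set.mem_univ w)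
  obtain rfl | ⟨u, ⟨e, he, hv, -⟩, -⟩ := Relation.ReflTransGen.cases_head walk
  · exact absurd rfl hw
  · exact (Set.ncard_pos).mpr ⟨e, he, hv⟩

/-! ### Starlike hypertrees -/

section Starlike

/-- A highest hyperedge of a cycle would meet both of its neighbours in the cycle at its root. -/
theorem not_isCycle_of_height {V ι : Type*} {H : Hypergraph V} {E : ι → Set V}
    (hE : H.edgeSet ⊆ Set.range E) (root : ι → V) (height : ι → ℕ)
    (h : ∀ s t, E s ≠ E t → ∀ x ∈ E s ∩ E t, x = root s ∨ height s < height t)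
    (q : ℕ) (v : Fin q → V) (e : Fin q → Set V) : ¬ H.IsCycle v e := by
  rintro ⟨hq, hv, he, hc⟩
  obtain ⟨n, rfl⟩ : ∃ n, q = n + 2 := Nat.exists_eq_add_of_le' hq
  have rotate_ne (i : Fin (n + 2)) : finRotate (n + 2) i ≠ i := by
    rw [finRotate_apply]
    simp
  choose s hs using fun i => hE (hc i).1
  obtain ⟨i, highest⟩ := Finite.exists_max fun i => height (s i)
  have eq_root {j : Fin (n + 2)} (hj : j ≠ i) {x : V} (hi : x ∈ e i) (hx : x ∈ e j) :
      x = root (s i) := by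
    refine (h (s i) (s j) ?_ x ⟨(hs i).symm ▸ hi, (hs j).symm ▸ hx⟩).resolve_right
      (highest j).not_gt
    rw [hs, hs]
    exact he.ne hj.symm
  obtain ⟨j, hj⟩ := (finRotate (n + 2)).surjective i
  have entry : v i = root (s i) :=
    eq_root (fun hji => rotate_ne j (hj.trans hji.symm)) (hc i).2.1 (hj ▸ (hc j).2.2)
  have exit : v (finRotate _ i) = root (s i) := eq_root (rotate_ne i) (hc i).2.2 (hc _).2.1
  exact rotate_ne i (hv (exit.trans entry.symm))

/-- The `j`-th hyperedge of a hyperpath with vertices `g 0, g 1, …`, whose consecutive hyperedges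
share one vertex and have `k` vertices each. -/
def pathEdge {W : Type*} (k : ℕ) (g : ℕ → W) (j : ℕ) : Set W :=
  g '' Set.Icc (j * (k - 1)) ((j + 1) * (k - 1))

theorem ncard_Icc_mul {k : ℕ} (hk : 1 ≤ k) (j : ℕ) :
    (Set.Icc (j * (k - 1)) ((j + 1) * (k - 1))).ncard = k := by
  rw [Set.ncard_eq_toFinset_card', Set.toFinset_Icc, Nat.card_Icc, Nat.succ_mul]
  omega

theorem ncard_pathEdge {W : Type*} {k : ℕ} (hk : 1 ≤ k) {g : ℕ → W} {j : ℕ}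
    (hg : Set.InjOn g (Set.Icc (j * (k - 1)) ((j + 1) * (k - 1)))) :
    (pathEdge k g j).ncard = k := by
  rw [pathEdge, hg.ncard_image, ncard_Icc_mul hk]

variable {k r : ℕ} {ℓ : Fin r → ℕ}

/-- The vertex at position `p` on leg `i` of a starlike hypertree; the common vertex `none` if
there is no such position. -/
def legVertex (i : Fin r) (p : ℕ) : StarlikeVertex k ℓ :=
  if h : 1 ≤ p ∧ p ≤ ℓ i * (k - 1) then some ⟨i, ⟨p - 1, by omega⟩⟩ else none

@[simp]
theorem legVertex_zero (i : Fin r) : (legVertex i 0 : StarlikeVertex k ℓ) = none := rfl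

theorem legVertex_add_one (i : Fin r) (p : Fin (ℓ i * (k - 1))) :
    (legVertex i (p + 1) : StarlikeVertex k ℓ) = some ⟨i, p⟩ := by
  rw [legVertex, dif_pos ⟨by omega, p.2⟩]
  rfl

theorem atPosition_iff {i : Fin r} {p : ℕ} (hp : p ≤ ℓ i * (k - 1)) {x : StarlikeVertex k ℓ} :
    AtPosition i p x ↔ legVertex i p = x := by
  rcases p with _ | p
  · rcases x with _ | y <;> simp [AtPosition]
  · rw [legVertex_add_one i ⟨p, hp⟩]
    rcases x with _ | ⟨i', p'⟩
    · simp [AtPosition]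
    · simp only [AtPosition, Option.some.injEq, Sigma.mk.injEq, Nat.add_right_cancel_iff]
      refine ⟨?_, ?_⟩
      · rintro ⟨rfl, rfl⟩
        exact ⟨rfl, HEq.rfl⟩
      · rintro ⟨rfl, h⟩
        exact ⟨rfl, congrArg Fin.val (eq_of_heq h)⟩

theorem legVertex_eq_legVertex {i i' : Fin r} {p p' : ℕ} (hp : p ≤ ℓ i * (k - 1))
    (hp' : p' ≤ ℓ i' * (k - 1)) (h : (legVertex i p : StarlikeVertex k ℓ) = legVertex i' p') :
    p = p' ∧ (i = i' ∨ p = 0) := by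
  rcases p with _ | p <;> rcases p' with _ | p'
  · simp
  · rw [legVertex_add_one i' ⟨p', hp'⟩] at h
    cases h
  · rw [legVertex_add_one i ⟨p, hp⟩] at h
    cases h
  · rw [legVertex_add_one i ⟨p, hp⟩, legVertex_add_one i' ⟨p', hp'⟩] at h
    cases h
    exact ⟨rfl, .inl rfl⟩

theorem position_le {i : Fin r} {j p : ℕ} (hj : j < ℓ i) (hp : p ≤ (j + 1) * (k - 1)) :
    p ≤ ℓ i * (k - 1) := hp.trans (Nat.mul_le_mul_right _ hj)

variable (k ℓ) in
theorem edgeSet_starlike : (starlike k ℓ).graph.edgeSet =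
    Set.range fun s : Σ i, Fin (ℓ i) =>
      pathEdge k (legVertex s.1 : ℕ → StarlikeVertex k ℓ) s.2 := by
  have edge_eq {i : Fin r} {j : ℕ} (hj : j < ℓ i) : {x : StarlikeVertex k ℓ |
      ∃ p, j * (k - 1) ≤ p ∧ p ≤ (j + 1) * (k - 1) ∧ AtPosition i p x} =
      pathEdge k (legVertex i) j := by
    ext x
    simp only [Set.mem_ofPred_eq, pathEdge, Set.mem_image, Set.mem_Icc, and_assoc]
    exact exists_congr fun p => and_congr_right fun _ => and_congr_right fun hp =>
      atPosition_iff (position_le hj hp)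
  refine Set.ext fun e => ⟨?_, ?_⟩
  · rintro ⟨i, j, hj, rfl⟩
    exact ⟨⟨i, j, hj⟩, (edge_eq hj).symm⟩
  · rintro ⟨⟨i, j, hj⟩, rfl⟩
    exact ⟨i, j, hj, (edge_eq hj).symm⟩

theorem pathEdge_mem_starlike {i : Fin r} {j : ℕ} (hj : j < ℓ i) :
    pathEdge k (legVertex i) j ∈ (starlike k ℓ).graph.edgeSet := by
  rw [edgeSet_starlike]
  exact ⟨⟨i, j, hj⟩, rfl⟩

theorem pathEdge_legVertex_injective (hk : 2 ≤ k) : Function.Injective fun s : Σ i, Fin (ℓ i) =>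
    pathEdge k (legVertex s.1 : ℕ → StarlikeVertex k ℓ) s.2 := by
  have le_of_subset {s t : Σ i, Fin (ℓ i)} (h :
      pathEdge k (legVertex s.1 : ℕ → StarlikeVertex k ℓ) s.2 ⊆ pathEdge k (legVertex t.1) t.2) :
      s.1 = t.1 ∧ s.2.val ≤ t.2.val := by
    obtain ⟨p, hp, heq⟩ := h ⟨(s.2 + 1) * (k - 1), ⟨Nat.mul_le_mul_right _ (Nat.le_succ _), le_rfl⟩,
      rfl⟩
    obtain ⟨rfl, hi⟩ := legVertex_eq_legVertex (position_le t.2.2 hp.2)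
      (position_le s.2.2 le_rfl) heq
    have last_ne_zero : (s.2.val + 1) * (k - 1) ≠ 0 := Nat.mul_ne_zero (by omega) (by omega)
    have := Nat.le_of_mul_le_mul_right hp.2 (by omega)
    exact ⟨(hi.resolve_right last_ne_zero).symm, by omega⟩
  rintro ⟨i, j⟩ ⟨i', j'⟩ h
  obtain ⟨rfl, hjj'⟩ := le_of_subset h.subset
  obtain ⟨-, hj'j⟩ := le_of_subset h.superset
  exact congrArg (Sigma.mk i) (Fin.ext (le_antisymm hjj' hj'j))

theorem ncard_edgeSet_starlike (hk : 2 ≤ k) : (starlike k ℓ).graph.edgeSet.ncard = ∑ i, ℓ i := by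
  rw [edgeSet_starlike, ← Set.image_univ]
  refine (Set.ncard_image_of_injective _ (pathEdge_legVertex_injective hk)).trans ?_
  rw [Set.ncard_univ, Nat.card_eq_fintype_card, Fintype.card_sigma]
  simp only [Fintype.card_fin]

theorem isUniform_starlike (hk : 1 ≤ k) : (starlike k ℓ).graph.IsUniform k := by
  have encard_edge (s : Σ i, Fin (ℓ i)) :
      (pathEdge k (legVertex s.1 : ℕ → StarlikeVertex k ℓ) s.2).encard = k := by
    rw [← (Set.toFinite _).cast_ncard_eq, ncard_pathEdge hk fun p hp p' hp' h =>
      (legVertex_eq_legVertex (position_le s.2.2 hp.2) (position_le s.2.2 hp'.2) h).1]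
  exact fun e he => by
    obtain ⟨s, rfl⟩ := (edgeSet_starlike k ℓ).subset he
    exact encard_edge s

theorem isConnected_starlike (hk : 2 ≤ k) : (starlike k ℓ).graph.IsConnected := by
  have reach_edge (i : Fin r) (j : ℕ) (hj : j < ℓ i) :
      ∀ x ∈ pathEdge k (legVertex i : ℕ → StarlikeVertex k ℓ) j,
        Relation.ReflTransGen (starlike k ℓ).graph.Adj none x := by
    induction j with
    | zero => exact fun x hx => .single ⟨_, pathEdge_mem_starlike hj, ⟨0, by simp, rfl⟩, hx⟩
    | succ j ih =>
      have shared := Nat.mul_le_mul_right (k - 1) (Nat.le_succ j)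
      have shared' := Nat.mul_le_mul_right (k - 1) (Nat.le_succ (j + 1))
      exact fun x hx => (ih (Nat.lt_of_succ_lt hj) _ ⟨_, ⟨shared, le_rfl⟩, rfl⟩).tail
        ⟨_, pathEdge_mem_starlike hj, ⟨_, ⟨le_rfl, shared'⟩, rfl⟩, hx⟩
  have reach (x : StarlikeVertex k ℓ) : Relation.ReflTransGen (starlike k ℓ).graph.Adj none x := by
    rcases x with _ | ⟨i, p⟩
    · exact .refl
    · refine reach_edge i (p / (k - 1)) (Nat.div_lt_of_lt_mul (p.2.trans_eq (mul_comm _ _))) _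
        ⟨p + 1, ⟨?_, ?_⟩, legVertex_add_one i p⟩
      · exact (Nat.div_mul_le_self _ _).trans (Nat.le_succ _)
      · exact (Nat.lt_mul_div_succ p.val (by omega)).trans_eq (mul_comm _ _)
  have : Std.Symm (starlike k ℓ).graph.Adj := ⟨fun _ _ h => h.symm⟩
  exact ⟨⟨none, Set.mem_univ _⟩, fun u _ v _ =>
    .trans (Relation.ReflTransGen.stdSymm.symm _ _ (reach u)) (reach v)⟩

theorem isHypertree_starlike (hk : 2 ≤ k) : (starlike k ℓ).graph.IsHypertree := by
  refine ⟨isConnected_starlike hk, not_isCycle_of_height (edgeSet_starlike k ℓ).subset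
    (fun s => legVertex s.1 (s.2 * (k - 1))) (fun s => s.2) ?_⟩
  rintro ⟨i, j⟩ ⟨i', j'⟩ hne _ ⟨⟨p, hp, rfl⟩, ⟨p', hp', heq⟩⟩
  obtain ⟨rfl, hi⟩ := legVertex_eq_legVertex (position_le j'.2 hp'.2) (position_le j.2 hp.2) heq
  refine or_iff_not_imp_right.mpr fun hj => congrArg (legVertex i) ?_
  rcases hi with rfl | rfl
  · have lt : j'.val < j.val :=
      lt_of_le_of_ne (not_lt.mp hj) fun h => hne (by rw [Fin.ext h])
    exact le_antisymm (hp'.2.trans (Nat.mul_le_mul_right _ lt)) hp.1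
  · exact (Nat.le_zero.mp hp.1).symm

theorem isUniformHypertree_starlike (hk : 2 ≤ k) :
    IsUniformHypertree k (∑ i, ℓ i) (starlike k ℓ) :=
  ⟨isUniform_starlike (by omega), isHypertree_starlike hk, ncard_edgeSet_starlike hk⟩

theorem le_deg_starlike_center (hk : 2 ≤ k) (hℓ : ∀ i, 1 ≤ ℓ i) :
    r ≤ (starlike k ℓ).graph.deg (none : StarlikeVertex k ℓ) := by
  let firstEdge (i : Fin r) : Set (StarlikeVertex k ℓ) := pathEdge k (legVertex i) 0
  have injective : Function.Injective firstEdge := fun i i' h =>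
    congrArg Sigma.fst <| pathEdge_legVertex_injective hk
      (a₁ := ⟨i, 0, hℓ i⟩) (a₂ := ⟨i', 0, hℓ i'⟩) h
  calc r = (Set.range firstEdge).ncard := by
        rw [← Set.image_univ, Set.ncard_image_of_injective _ injective, Set.ncard_univ,
          Nat.card_fin]
    _ ≤ _ := Set.ncard_le_ncard (by
        rintro _ ⟨i, rfl⟩
        exact ⟨pathEdge_mem_starlike (hℓ i), 0, by simp, rfl⟩)
      (Set.toFinite (α := Set (StarlikeVertex k ℓ)) _)

end Starlike

/-! ### Recognizing stars and near-stars -/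

section Recognition

theorem iso_of_image_edgeSet_eq {H₁ H₂ : FinHypergraph} (σ : H₂.V ≃ H₁.V)
    (h : Set.image σ '' H₂.graph.edgeSet = H₁.graph.edgeSet) : Iso H₁ H₂ := by
  refine ⟨σ.symm, Hypergraph.ext ?_ ?_⟩
  · rw [Hypergraph.image_vertexSet, H₁.vertexSet_eq, H₂.vertexSet_eq,
      Set.image_univ_of_surjective σ.symm.surjective]
  · ext e
    simp only [Hypergraph.mem_edgeSet_image, ← h, Set.exists_mem_image, Equiv.symm_image_image,
      exists_eq_right]

theorem Iso.exists_forall_mem_edge {H₁ H₂ : FinHypergraph} (h : Iso H₁ H₂)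
    (h₂ : ∃ v, ∀ e ∈ H₂.graph.edgeSet, v ∈ e) : ∃ v, ∀ e ∈ H₁.graph.edgeSet, v ∈ e := by
  obtain ⟨σ, hσ⟩ := h
  obtain ⟨v, hv⟩ := h₂
  refine ⟨σ.symm v, fun e he => ?_⟩
  rw [← Set.mem_image_equiv]
  exact hv _ (hσ ▸ Hypergraph.image_mem_edgeSet_image he)

theorem exists_pathEdge_eq {W : Type*} {k : ℕ} (hk : 1 ≤ k) {e : Set W} (he : e.ncard = k) (j : ℕ)
    {s : Set ℕ} (hs : s ⊆ Set.Icc (j * (k - 1)) ((j + 1) * (k - 1))) {f : ℕ → W}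
    (hf : s.MapsTo f e) (hinj : s.InjOn f) :
    ∃ g : ℕ → W, (∀ p, p ∈ s ∨ p ∉ Set.Icc (j * (k - 1)) ((j + 1) * (k - 1)) → g p = f p) ∧
      pathEdge k g j = e := by
  classical
  have finite : e.Finite := Set.finite_of_ncard_pos (he ▸ hk)
  have card_eq : Fintype.card (Set.Icc (j * (k - 1)) ((j + 1) * (k - 1))) =
      finite.toFinset.card := by
    rw [← Set.ncard_eq_toFinset_card e finite, he, Fintype.card_eq_nat_card, Nat.card_coe_set_eq,
      ncard_Icc_mul hk]
  obtain ⟨φ, hφ⟩ := Set.MapsTo.exists_equiv_extend_of_card_eq card_eq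
    (s := Subtype.val ⁻¹' s) (f := fun p => f p) (fun p hp => finite.mem_toFinset.mpr (hf hp))
    fun p hp q hq h => Subtype.ext (hinj hp hq h)
  let g (p : ℕ) : W :=
    if h : p ∈ Set.Icc (j * (k - 1)) ((j + 1) * (k - 1)) then φ ⟨p, h⟩ else f p
  have g_eq {p : ℕ} (h : p ∈ Set.Icc (j * (k - 1)) ((j + 1) * (k - 1))) : g p = φ ⟨p, h⟩ :=
    dif_pos h
  refine ⟨g, ?_, Set.Subset.antisymm ?_ fun x hx => ?_⟩
  · rintro p (hp | hp)
    · exact (g_eq (hs hp)).trans (hφ ⟨p, hs hp⟩ hp)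
    · exact dif_neg hp
  · rintro _ ⟨p, hp, rfl⟩
    exact g_eq hp ▸ finite.mem_toFinset.mp (φ _).2
  · obtain ⟨p, hp⟩ := φ.surjective ⟨x, finite.mem_toFinset.mpr hx⟩
    exact ⟨p, p.2, (g_eq p.2).trans (congrArg Subtype.val hp)⟩

variable {k m r : ℕ} {ℓ : Fin r → ℕ} {T : FinHypergraph}

theorem exists_leg_of_mem {W : Type*} (hk : 1 ≤ k) {e : Set W} (he : e.ncard = k) {v : W}
    (hv : v ∈ e) : ∃ g : ℕ → W, g 0 = v ∧ pathEdge k g 0 = e := by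
  obtain ⟨g, hg, hge⟩ := exists_pathEdge_eq hk he 0 (s := {0}) (f := fun _ => v) (by simp)
    (by simpa using hv) (by simp)
  exact ⟨g, hg 0 (.inl rfl), hge⟩

theorem exists_leg_of_mem_of_mem {W : Type*} (hk : 2 ≤ k) {e f : Set W} (he : e.ncard = k)
    (hf : f.ncard = k) {u v : W} (hv : v ∈ e) (hue : u ∈ e) (huf : u ∈ f) (huv : u ≠ v) :
    ∃ g : ℕ → W, g 0 = v ∧ pathEdge k g 0 = e ∧ pathEdge k g 1 = f := by
  have last_ne_zero : k - 1 ≠ 0 := by omega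
  obtain ⟨g₀, hg₀, hg₀e⟩ := exists_pathEdge_eq (by omega) he 0 (s := {0, k - 1})
    (f := fun p => if p = 0 then v else u) (by simp [Set.insert_subset_iff])
    (by rintro p (rfl | rfl) <;> simp [last_ne_zero, hv, hue])
    (by rw [Set.injOn_pair]; simp [last_ne_zero, huv.symm])
  have g₀_zero : g₀ 0 = v := hg₀ 0 (.inl (.inl rfl))
  have g₀_last : g₀ (k - 1) = u := (hg₀ _ (.inl (.inr rfl))).trans (if_neg last_ne_zero)
  obtain ⟨g, hg, hgf⟩ := exists_pathEdge_eq (by omega) hf 1 (s := {k - 1}) (f := g₀)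
    (by rw [Set.singleton_subset_iff, Set.mem_Icc]; omega)
    (by rwa [Set.mapsTo_singleton, g₀_last]) (Set.injOn_singleton _ _)
  have g_eq {p : ℕ} (hp : p ≤ k - 1) : g p = g₀ p := by
    refine hg p ?_
    rw [Set.mem_singleton_iff, Set.mem_Icc]
    omega
  refine ⟨g, (g_eq (Nat.zero_le _)).trans g₀_zero, ?_, hgf⟩
  rw [← hg₀e]
  exact Set.image_congr fun p hp => g_eq (by simpa using hp.2)

theorem iso_starlike (hk : 2 ≤ k) (hm : 1 ≤ m) (hT : IsUniformHypertree k m T)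
    (hℓ : ∑ i, ℓ i = m) (v : T.V) (g : Fin r → ℕ → T.V) (hg : ∀ i, g i 0 = v)
    (hE : T.graph.edgeSet = Set.range fun s : Σ i, Fin (ℓ i) => pathEdge k (g s.1) s.2) :
    Iso T (starlike k ℓ) := by
  let τ : StarlikeVertex k ℓ → T.V := fun x => x.elim v fun y => g y.1 (y.2 + 1)
  have τ_legVertex (i : Fin r) {p : ℕ} (hp : p ≤ ℓ i * (k - 1)) : τ (legVertex i p) = g i p := by
    rcases p with _ | p
    · exact (hg i).symm
    · rw [legVertex_add_one i ⟨p, hp⟩]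
      rfl
  have image_edge (s : Σ i, Fin (ℓ i)) : τ '' pathEdge k (legVertex s.1) s.2 =
      pathEdge k (g s.1) s.2 := by
    rw [pathEdge, Set.image_image]
    exact Set.image_congr fun p hp => τ_legVertex s.1 (position_le s.2.2 hp.2)
  have surjective : Function.Surjective τ := fun w => by
    obtain ⟨e, he, hw⟩ := (Set.ncard_pos).mp (hT.one_le_deg hk hm w)
    obtain ⟨s, rfl⟩ := hE.subset he
    obtain ⟨x, -, hx⟩ := (image_edge s).superset hw
    exact ⟨x, hx⟩
  have card_eq : Fintype.card (StarlikeVertex k ℓ) = Fintype.card T.V := by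
    have hS := (isUniformHypertree_starlike (ℓ := ℓ) hk).card_add (by omega)
    rw [hℓ, ← hT.card_add (by omega)] at hS
    exact Nat.add_right_cancel hS
  have bijective := (Fintype.bijective_iff_surjective_and_card τ).mpr ⟨surjective, card_eq⟩
  refine iso_of_image_edgeSet_eq (H₂ := starlike k ℓ) (Equiv.ofBijective τ bijective) ?_
  calc Set.image τ '' (starlike k ℓ).graph.edgeSet
      = Set.range (Set.image τ ∘ fun s : Σ i, Fin (ℓ i) => pathEdge k (legVertex s.1) s.2) := by
        rw [Set.range_comp, ← edgeSet_starlike]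
    _ = T.graph.edgeSet := by rw [hE, ← funext image_edge]; rfl

theorem IsUniformHypertree.deg_le (hT : IsUniformHypertree k m T) (v : T.V) :
    T.graph.deg v ≤ m :=
  hT.2.2 ▸ Set.ncard_le_ncard (fun _ he => he.1)

theorem iso_star_of_deg_eq (hk : 2 ≤ k) (hm : 1 ≤ m) (hT : IsUniformHypertree k m T) {v : T.V}
    (hv : T.graph.deg v = m) : Iso T (starlike k fun _ : Fin m => 1) := by
  have mem_edge : {e | e ∈ T.graph.edgeSet ∧ v ∈ e} = T.graph.edgeSet :=
    Set.eq_of_subset_of_ncard_le (fun e he => he.1) (hT.2.2.trans_le hv.ge)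
  let φ : {e | e ∈ T.graph.edgeSet ∧ v ∈ e} ≃ Fin m := Finite.equivFinOfCardEq hv
  choose g hg0 hg using fun i => exists_leg_of_mem (by omega) (hT.ncard_edge (φ.symm i).2.1)
    (φ.symm i).2.2
  refine iso_starlike hk hm hT (by simp) v g hg0 (Set.ext fun e => ⟨fun he => ?_, ?_⟩)
  · exact ⟨⟨φ ⟨e, mem_edge.superset he⟩, 0⟩, (hg _).trans (by rw [Equiv.symm_apply_apply])⟩
  · rintro ⟨⟨i, j⟩, rfl⟩
    obtain rfl : j = 0 := Subsingleton.elim _ _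
    change pathEdge k (g i) 0 ∈ T.graph.edgeSet
    rw [hg]
    exact (φ.symm i).2.1

/-- The leg lengths `1, 2, 1, …, 1` of the starlike hypertree with `m` hyperedges in which all
but one hyperedge contain the common vertex. -/
abbrev nearStarLegs (m : ℕ) : Fin (m - 1) → ℕ := fun i => if i.val = 1 then 2 else 1

theorem one_le_nearStarLegs (i : Fin (m - 1)) : 1 ≤ nearStarLegs m i := by
  rw [nearStarLegs]
  split_ifs <;> norm_num

theorem sum_nearStarLegs (hm : 3 ≤ m) : ∑ i, nearStarLegs m i = m := by
  have legs_eq (i : Fin (m - 1)) :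
      nearStarLegs m i = 1 + if i = ⟨1, by omega⟩ then 1 else 0 := by
    simp only [nearStarLegs, Fin.ext_iff]
    split_ifs <;> rfl
  rw [Finset.sum_congr rfl fun i _ => legs_eq i, Finset.sum_add_distrib, Finset.sum_ite_eq',
    if_pos (Finset.mem_univ _), Finset.sum_const, Finset.card_univ, Fintype.card_fin, smul_eq_mul]
  omega

theorem range_pathEdge_nearStarLegs {W : Type*} (g : Fin (m - 1) → ℕ → W) {i₁ : Fin (m - 1)}
    (hi₁ : i₁.val = 1) :
    Set.range (fun s : Σ i, Fin (nearStarLegs m i) => pathEdge k (g s.1) s.2) =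
      insert (pathEdge k (g i₁) 1) (Set.range fun i => pathEdge k (g i) 0) := by
  refine Set.Subset.antisymm ?_ (Set.insert_subset ?_ ?_)
  · rintro _ ⟨⟨i, j, hj⟩, rfl⟩
    rcases Nat.eq_zero_or_pos j with rfl | hj₀
    · exact .inr ⟨i, rfl⟩
    · by_cases hi : i.val = 1
      · rw [nearStarLegs, if_pos hi] at hj
        obtain rfl : j = 1 := by omega
        obtain rfl : i = i₁ := Fin.ext (hi.trans hi₁.symm)
        exact .inl rfl
      · rw [nearStarLegs, if_neg hi] at hj
        omega
  · have two_edges : 1 < nearStarLegs m i₁ := by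
      rw [nearStarLegs, if_pos hi₁]
      exact Nat.one_lt_two
    exact ⟨⟨i₁, 1, two_edges⟩, rfl⟩
  · rintro _ ⟨i, rfl⟩
    exact ⟨⟨i, 0, one_le_nearStarLegs i⟩, rfl⟩

theorem exists_edge_crossing {V : Type*} {H : Hypergraph V} (hH : H.IsConnected) {s : Set V}
    {v w : V} (hv : v ∈ H.vertexSet) (hw : w ∈ H.vertexSet) (hvs : v ∉ s) (hws : w ∈ s) :
    ∃ e ∈ H.edgeSet, ∃ x ∈ e, x ∉ s ∧ ∃ y ∈ e, y ∈ s := by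
  induction hH.2 v hv w hw with
  | refl => exact absurd hws hvs
  | @tail x y _ hxy ih =>
    obtain ⟨e, he, hx, hy⟩ := hxy
    by_cases hxs : x ∈ s
    · exact ih (H.subset_vertexSet_of_mem_edgeSet he hx) hxs
    · exact ⟨e, he, x, hx, hxs, y, hy, hws⟩

theorem IsUniformHypertree.exists_edgeSet_eq_insert (hT : IsUniformHypertree k m T) {v : T.V}
    (hv : T.graph.deg v + 1 = m) :
    ∃ f, v ∉ f ∧ T.graph.edgeSet = insert f {e | e ∈ T.graph.edgeSet ∧ v ∈ e} := by
  have diff : (T.graph.edgeSet \ {e | e ∈ T.graph.edgeSet ∧ v ∈ e}).ncard = 1 := by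
    have := Set.ncard_sdiff_add_ncard_of_subset (s := {e | e ∈ T.graph.edgeSet ∧ v ∈ e})
      (t := T.graph.edgeSet) (fun e he => he.1)
    rw [hT.2.2, ← hv, ← Hypergraph.deg] at this
    omega
  obtain ⟨f, hf⟩ := Set.ncard_eq_one.mp diff
  have mem_f := hf.superset (Set.mem_singleton f)
  refine ⟨f, fun h => mem_f.2 ⟨mem_f.1, h⟩, ?_⟩
  rw [← Set.singleton_union, ← hf, Set.sdiff_union_of_subset fun e he => he.1]

theorem iso_nearStar_of_deg_add_one_eq (hk : 2 ≤ k) (hm : 3 ≤ m) (hT : IsUniformHypertree k m T)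
    {v : T.V} (hv : T.graph.deg v + 1 = m) : Iso T (starlike k (nearStarLegs m)) := by
  obtain ⟨f, hvf, hE⟩ := hT.exists_edgeSet_eq_insert hv
  have hf : f ∈ T.graph.edgeSet := hE.superset (Set.mem_insert _ _)
  obtain ⟨w, hw⟩ : f.Nonempty := by
    rw [← Set.ncard_pos, hT.ncard_edge hf]
    omega
  obtain ⟨e₁, he₁, x, hx, hxf, u, hu, huf⟩ := exists_edge_crossing hT.2.1.1
    (T.vertexSet_eq ▸ Set.mem_univ v) (T.vertexSet_eq ▸ Set.mem_univ w) hvf hw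
  have hve₁ : v ∈ e₁ := by
    rcases hE.subset he₁ with rfl | h
    · exact absurd hx hxf
    · exact h.2
  let i₁ : Fin (m - 1) := ⟨1, by omega⟩
  obtain ⟨φ, hφ⟩ : ∃ φ : Fin (m - 1) ≃ {e | e ∈ T.graph.edgeSet ∧ v ∈ e},
      φ i₁ = ⟨e₁, he₁, hve₁⟩ := by
    let ψ := (Finite.equivFinOfCardEq (Nat.eq_sub_of_add_eq hv)).symm
    exact ⟨(Equiv.swap i₁ (ψ.symm ⟨e₁, he₁, hve₁⟩)).trans ψ, by simp⟩
  have leg (i : Fin (m - 1)) : ∃ g : ℕ → T.V,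
      g 0 = v ∧ pathEdge k g 0 = φ i ∧ (i = i₁ → pathEdge k g 1 = f) := by
    by_cases hi : i = i₁
    · obtain ⟨g, hg0, hg, hgf⟩ := exists_leg_of_mem_of_mem hk (hT.ncard_edge he₁) (hT.ncard_edge hf)
        hve₁ hu huf fun h => hvf (h ▸ huf)
      exact ⟨g, hg0, by rw [hi, hφ, hg], fun _ => hgf⟩
    · obtain ⟨g, hg0, hg⟩ := exists_leg_of_mem (by omega) (hT.ncard_edge (φ i).2.1) (φ i).2.2
      exact ⟨g, hg0, hg, fun h => absurd h hi⟩
  choose g hg0 hg hgf using leg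
  refine iso_starlike hk (by omega) hT (sum_nearStarLegs hm) v g hg0 ?_
  rw [range_pathEdge_nearStarLegs g (i₁ := i₁) rfl, hgf i₁ rfl, hE, funext hg]
  congr 1
  exact (φ.surjective.range_comp Subtype.val).trans Subtype.range_coe |>.symm

theorem not_iso_nearStar_star (hk : 2 ≤ k) (hm : 3 ≤ m) :
    ¬ Iso (starlike k (nearStarLegs m)) (starlike k fun _ : Fin m => 1) := by
  intro h
  have star_center : ∀ e ∈ (starlike k fun _ : Fin m => 1).graph.edgeSet, none ∈ e := fun e he => by
    obtain ⟨⟨i, j⟩, rfl⟩ := (edgeSet_starlike k _).subset he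
    obtain rfl : j = 0 := Subsingleton.elim _ _
    exact ⟨0, by simp, rfl⟩
  obtain ⟨x, hx⟩ := h.exists_forall_mem_edge ⟨_, star_center⟩
  have hj₀ : 0 < nearStarLegs m ⟨0, by omega⟩ := Nat.one_pos
  have hj₁ : 1 < nearStarLegs m ⟨1, by omega⟩ := Nat.one_lt_two
  obtain ⟨p, hp, hpx⟩ := hx _ (pathEdge_mem_starlike hj₀)
  obtain ⟨q, hq, hqx⟩ := hx _ (pathEdge_mem_starlike hj₁)
  obtain ⟨rfl, hi | rfl⟩ := legVertex_eq_legVertex (position_le hj₀ hp.2) (position_le hj₁ hq.2)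
    (hpx.trans hqx.symm)
  · simp at hi
  · have := hq.1
    omega

end Recognition

/-! ### Comparing hypertrees by their degrees -/

section Order

theorem sum_sq_add_mul_card_le {ι : Type*} [Fintype ι] {d : ι → ℕ} {b : ℕ} (one_le : ∀ i, 1 ≤ d i)
    (le : ∀ i, d i ≤ b) : ∑ i, d i ^ 2 + b * Fintype.card ι ≤ (b + 1) * ∑ i, d i := by
  -- On `[1, b]` the square lies below its secant line through `1` and `b`.
  have term (i : ι) : d i ^ 2 + b ≤ (b + 1) * d i := by
    obtain ⟨c, hc⟩ := Nat.exists_eq_add_of_le (one_le i)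
    nlinarith [le i]
  calc ∑ i, d i ^ 2 + b * Fintype.card ι = ∑ i, (d i ^ 2 + b) := by
        rw [Finset.sum_add_distrib, Finset.sum_const, Finset.card_univ, smul_eq_mul, mul_comm b]
    _ ≤ (b + 1) * ∑ i, d i := by
        rw [Finset.mul_sum]
        exact Finset.sum_le_sum fun i _ => term i

theorem le_sum_sq_add_mul_card {ι : Type*} [Fintype ι] (d : ι → ℕ) {b : ℕ} (hb : 1 ≤ b) {i₀ : ι}
    (hi₀ : b ≤ d i₀) :
    3 * ∑ i, d i + b ^ 2 + 2 ≤ ∑ i, d i ^ 2 + 2 * Fintype.card ι + 3 * b := by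
  classical
  -- On the integers the square lies above its secant line through `1` and `2`.
  have term (n : ℕ) : 3 * n ≤ n ^ 2 + 2 := by
    obtain h | h := le_or_gt n 1
    · interval_cases n <;> norm_num
    · nlinarith
  have term₀ : 3 * d i₀ + b ^ 2 ≤ d i₀ ^ 2 + 3 * b := by
    obtain ⟨c, hc⟩ := Nat.exists_eq_add_of_le hi₀
    have := term (c + 1)
    nlinarith
  have rest := Finset.sum_le_sum fun i (_ : i ∈ Finset.univ.erase i₀) => term (d i)
  rw [← Finset.mul_sum, Finset.sum_add_distrib, Finset.sum_const, smul_eq_mul] at rest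
  have card := Finset.card_erase_add_one (Finset.mem_univ i₀)
  rw [Finset.card_univ] at card
  rw [← Finset.add_sum_erase _ _ (Finset.mem_univ i₀), ← Finset.add_sum_erase _ (fun i => d i ^ 2)
    (Finset.mem_univ i₀)]
  linarith

variable {k m : ℕ} {T T' : FinHypergraph}

theorem sPrec_of_sum_deg_sq_lt (hk : 2 ≤ k) (hm : 2 ≤ m) {a : ℝ} (ha : a ≠ 0)
    (hT : IsUniformHypertree k m T) (hT' : IsUniformHypertree k m T')
    (h : ∑ v, T.graph.deg v ^ 2 < ∑ v, T'.graph.deg v ^ 2) : SPrec k a T T' := by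
  have hcard := hT.card_add (by omega)
  have card_eq : Fintype.card T.V = Fintype.card T'.V :=
    Nat.add_right_cancel (hcard.trans (hT'.card_add (by omega)).symm)
  have sum_deg_eq : ∑ v, (T.graph.deg v : ℝ) = ∑ v, (T'.graph.deg v : ℝ) := by
    exact_mod_cast hT.sum_deg.trans hT'.sum_deg.symm
  refine ⟨card_eq, 2, one_le_two, ?_, fun t ht => ?_, ?_⟩
  · have three_le : 3 ≤ Fintype.card T.V := by nlinarith
    have := Nat.mul_le_mul three_le (Nat.one_le_pow (Fintype.card T.V - 1) (k - 1) (by omega))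
    omega
  · interval_cases t
    · simp only [moment, KTensor.trace_alphaTensor_of_lt hk hT.1 a (by omega : 0 < k),
        KTensor.trace_alphaTensor_of_lt hk hT'.1 a (by omega : 0 < k), pow_zero, Finset.sum_const,
        Finset.card_univ, card_eq]
    · rw [moment, moment, KTensor.trace_alphaTensor_one hk hT.1,
        KTensor.trace_alphaTensor_one hk hT'.1, card_eq, sum_deg_eq]
  · rw [moment, moment, KTensor.trace_alphaTensor_two hk hT.1,
      KTensor.trace_alphaTensor_two hk hT'.1, card_eq, sum_deg_eq]
    have sum_deg_sq_lt : ∑ v, (T.graph.deg v : ℝ) ^ 2 < ∑ v, (T'.graph.deg v : ℝ) ^ 2 := by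
      exact_mod_cast h
    have factor_pos : (0 : ℝ) < ((k - 1 : ℕ) : ℝ) ^ (Fintype.card T'.V - 1) :=
      pow_pos (by exact_mod_cast (by omega : 0 < k - 1)) _
    gcongr

theorem sPrec_of_deg_le_of_lt_deg (hk : 2 ≤ k) (hm : 2 ≤ m) {a : ℝ} (ha : a ≠ 0)
    (hT : IsUniformHypertree k m T) (hT' : IsUniformHypertree k m T') {b : ℕ}
    (hb : b * m + 2 < 2 * m + b ^ 2) (le : ∀ v, T.graph.deg v ≤ b) {v' : T'.V}
    (lt : b < T'.graph.deg v') : SPrec k a T T' := by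
  refine sPrec_of_sum_deg_sq_lt hk hm ha hT hT' ?_
  have upper := sum_sq_add_mul_card_le (hT.one_le_deg hk (by omega)) le
  have lower := le_sum_sq_add_mul_card T'.graph.deg (Nat.le_add_left 1 b) lt
  rw [hT.sum_deg] at upper
  rw [hT'.sum_deg] at lower
  have card := hT.card_add (by omega)
  have card' := hT'.card_add (by omega)
  nlinarith

variable (m) in
theorem isUniformHypertree_star (hk : 2 ≤ k) :
    IsUniformHypertree k m (starlike k fun _ : Fin m => 1) := by
  simpa using isUniformHypertree_starlike (ℓ := fun _ : Fin m => 1) hk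

theorem isUniformHypertree_nearStar (hk : 2 ≤ k) (hm : 3 ≤ m) :
    IsUniformHypertree k m (starlike k (nearStarLegs m)) := by
  have := isUniformHypertree_starlike (ℓ := nearStarLegs m) hk
  rwa [sum_nearStarLegs hm] at this

theorem star_isLast (hk : 2 ≤ k) (hm : 2 ≤ m) {a : ℝ} (ha : a ≠ 0) :
    IsLast k a (IsUniformHypertree k m) (starlike k fun _ : Fin m => 1) := by
  have star := isUniformHypertree_star m hk
  refine ⟨star, fun T hT not_star => ?_⟩
  obtain ⟨b, rfl⟩ : ∃ b, m = b + 1 := Nat.exists_eq_add_of_le' (by omega)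
  refine sPrec_of_deg_le_of_lt_deg hk hm ha hT star (b := b) (by nlinarith) (fun v => ?_)
    (le_deg_starlike_center hk fun _ => le_rfl)
  exact Nat.le_of_lt_succ <| (hT.deg_le v).lt_of_ne fun hv =>
    not_star (iso_star_of_deg_eq hk (by omega) hT hv)

theorem nearStar_isLast (hk : 2 ≤ k) (hm : 3 ≤ m) {a : ℝ} (ha : a ≠ 0) :
    IsLast k a (fun T => IsUniformHypertree k m T ∧ ¬ Iso T (starlike k fun _ : Fin m => 1))
      (starlike k (nearStarLegs m)) := by
  have nearStar := isUniformHypertree_nearStar hk hm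
  refine ⟨⟨nearStar, not_iso_nearStar_star hk hm⟩, fun T ⟨hT, not_star⟩ not_nearStar => ?_⟩
  obtain ⟨b, rfl⟩ : ∃ b, m = b + 2 := Nat.exists_eq_add_of_le' (by omega)
  refine sPrec_of_deg_le_of_lt_deg hk (by omega) ha hT nearStar (b := b) (by nlinarith)
    (fun v => ?_) (le_deg_starlike_center hk (one_le_nearStarLegs (m := b + 2)))
  have le := hT.deg_le v
  have ne_star : T.graph.deg v ≠ b + 2 := fun hv =>
    not_star (iso_star_of_deg_eq hk (by omega) hT hv)
  have ne_nearStar : T.graph.deg v + 1 ≠ b + 2 := fun hv =>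
    not_nearStar (iso_nearStar_of_deg_add_one_eq hk hm hT hv)
  omega

end Order

end FinHypergraph

theorem mainTheorem7_general (k m : ℕ) (hk : 2 ≤ k) (hm : 3 ≤ m) {a : ℝ} (ha : a ≠ 0) :
    FinHypergraph.IsSecondLast k a (FinHypergraph.IsUniformHypertree k m)
      (FinHypergraph.starlike k (fun i : Fin (m - 1) => if i.val = 1 then 2 else 1)) :=
  ⟨_, FinHypergraph.star_isLast hk (by omega) ha, FinHypergraph.nearStar_isLast hk hm ha⟩

theorem mainTheorem7 (k m : ℕ) (hk : 2 ≤ k) (hm : 3 ≤ m) (a : ℝ) (ha0 : 0 < a) (ha1 : a < 1) :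
    FinHypergraph.IsSecondLast k a (FinHypergraph.IsUniformHypertree k m)
      (FinHypergraph.starlike k
        (fun i : Fin (m - 1) => if i.val = 1 then 2 else 1)) :=
  mainTheorem7_general k m hk hm ha0.ne'
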